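/- **Setting.** Let $p=p(n)\to\infty$ with $p=o(n)$ as $n\to\infty$, and let $\Sigma^{(n)}\in\mathbb R^{p\times p}$ be covariance matrices whose smallest eigenvalues satisfy $\lambda_{\min}(\Sigma^{(n)})\ge\gamma$ for a fixed constant $\gamma>0$. Fix a noise level $\sigma\ge 0$, a nominal level $q\in(0,1]$, a fraction $s_0\in(0,1]$ and a side length $b>0$. *Knockoffs.* For a diagonal matrix $S$ put $G_S=\begin{bmatrix}\Sigma^{(n)}&\Sigma^{(n)}-S\\ \Sigma^{(n)}-S&\Sigma^{(n)}\end{bmatrix}$. Let $S_{\mathrm{MVR}}=S_{\mathrm{MVR}}^{(n)}$ be a diagonal matrix which, among all diagonal $S$ with $G_S\succcurlyeq 0$, minimizes $$L_{\mathrm{MVR}}(S)=\sum_{j=1}^p\frac{1}{\mathbb E[\operatorname{Var}(X_j\mid X_{-j},\tilde X)]},\qquad [X,\tilde X]\sim\mathcal N(0,G_S),$$ where $1/0=\infty$ and $X_{-j}$ denotes all the features except $X_j$. *Data.* For $\beta\in\mathbb R^p$ let $\mathbb P_\beta$ and $\mathbb E_\beta$ refer to $n$ i.i.d. observations of $([X,\tilde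 X],Y)$ with $[X,\tilde X]\sim\mathcal N(0,G_{S_{\mathrm{MVR}}})$ and $Y=X\beta+\xi$, where $\xi\sim\mathcal N(0,\sigma^2)$ is independent of $[X,\tilde X]$. Let $([\mathbf X,\tilde{\mathbf X}],\mathbf y)$ be the stacked data, let $\hat\beta^{(\mathrm{ext})}\in\mathbb R^{2p}$ be the OLS coefficients of $\mathbf y$ on $[\mathbf X,\tilde{\mathbf X}]$ (set to zero if these are not unique), and let $$W_j=|\hat\beta^{(\mathrm{ext})}_j|-|\hat\beta^{(\mathrm{ext})}_{j+p}|,\qquad 1\le j\le p,$$ which defines the feature statistic $W=w([\mathbf X,\tilde{\mathbf X}],\mathbf y)$. *Selection and power.* Let $\hat S=\{j:W_j\ge T\}$, where $$T=\min\Big\{t\in\{|W_1|,\dots,|W_p|\}\setminus\{0\}:\ \frac{\#\{j:W_j\le -t\}+1}{\#\{j:W_j\ge t\}}\le q\Big\},$$ a ratio with denominator $0$ counting as $\infty$, and $T=\infty$ if the set is empty. The power is $$\operatorname{Power}(w,\beta)=\frac{\mathbb E_{\beta}\big[\,|\hat S\cap\{j:\beta_j\ne0\}|\,\big]}{|\{j:\beta_j\neq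 0\}|}.$$ *Random coefficients.* Let $\beta^{(n)}\in\mathbb R^p$ be random: a uniformly drawn set of $\lceil s_0p\rceil$ coordinates is filled with a uniform point of the $\lceil s_0p\rceil$-dimensional hypercube of side length $b$ centered at $0$, and all other coordinates are $0$. **Theorem.** Under these assumptions: 1. for every $\epsilon>0$, $$\lim_{n\to\infty}\ \sup_{\beta\in\mathbb R^p}\ \mathbb P_{\beta}\Big[\sum_{j=1}^p\big(W_j-|\beta_j|\big)^2>\epsilon\Big]=0;$$ 2. $\operatorname{Power}(w,\beta^{(n)})\to 1$ in probability as $n\to\infty$, the probability being over the random $\beta^{(n)}$. -/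

import Mathlib

open MeasureTheory ProbabilityTheory Filter Topology
open scoped ENNReal NNReal Matrix

namespace Knockoff

noncomputable section

/-- The joint covariance matrix `G_S` of the features and their knockoffs, for `S = diag s`.
The index `Sum.inl j` stands for the feature `X_j`, `Sum.inr j` for its knockoff. -/
def jointCov {p : ℕ} (Sig : Matrix (Fin p) (Fin p) ℝ) (s : Fin p → ℝ) :
    Matrix (Fin p ⊕ Fin p) (Fin p ⊕ Fin p) ℝ :=
  Matrix.fromBlocks Sig (Sig - Matrix.diagonal s) (Sig - Matrix.diagonal s) Sig

/-- The law of a feature vector together with its knockoff: the centered Gaussian law with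
covariance `G_S` (a genuine Gaussian with that covariance as soon as `G_S` is positive
semidefinite). -/
def featureLaw {p : ℕ} (Sig : Matrix (Fin p) (Fin p) ℝ) (s : Fin p → ℝ) :
    Measure (EuclideanSpace ℝ (Fin p ⊕ Fin p)) :=
  multivariateGaussian 0 (jointCov Sig s)

/-- The sigma-algebra generated by all the features but the `j`-th and by all the knockoffs. -/
abbrev restSigma {p : ℕ} (j : Fin p) : MeasurableSpace (EuclideanSpace ℝ (Fin p ⊕ Fin p)) :=
  MeasurableSpace.comap
    (fun z (k : {k : Fin p ⊕ Fin p // k ≠ Sum.inl j}) => z k.1) inferInstance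

/-- `E[Var(X_j | X_{-j}, knockoffs)]`. -/
def expectedCondVar {p : ℕ} (Sig : Matrix (Fin p) (Fin p) ℝ) (s : Fin p → ℝ) (j : Fin p) : ℝ :=
  ∫ z, (condVar (restSigma j) (fun z : EuclideanSpace ℝ (Fin p ⊕ Fin p) => z (Sum.inl j))
    (featureLaw Sig s)) z ∂(featureLaw Sig s)

/-- The variance-based reconstructability loss `∑ j, 1 / E[Var(X_j | X_{-j}, knockoffs)]`, with
values in `[0, ∞]`: it is infinite when some feature can be reconstructed exactly. -/
def mvrLoss {p : ℕ} (Sig : Matrix (Fin p) (Fin p) ℝ) (s : Fin p → ℝ) : ℝ≥0∞ :=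
  ∑ j, (ENNReal.ofReal (expectedCondVar Sig s j))⁻¹

/-- `S = diag s` is the MVR choice for Gaussian features with covariance `Sig`: it is feasible,
that is `G_S` is positive semidefinite, and it minimizes the loss among all feasible choices. -/
def IsMVR {p : ℕ} (Sig : Matrix (Fin p) (Fin p) ℝ) (s : Fin p → ℝ) : Prop :=
  (jointCov Sig s).PosSemidef ∧
    ∀ s' : Fin p → ℝ, (jointCov Sig s').PosSemidef → mvrLoss Sig s ≤ mvrLoss Sig s'

/-- The law of one observation (features and knockoffs, response): the response is
`X β` plus an independent centered Gaussian noise of variance `σ ^ 2`. In particular it is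
independent of the knockoffs given the features. -/
def obsLaw {p : ℕ} (Sig : Matrix (Fin p) (Fin p) ℝ) (s : Fin p → ℝ) (σ : ℝ≥0)
    (β : Fin p → ℝ) : Measure (EuclideanSpace ℝ (Fin p ⊕ Fin p) × ℝ) :=
  ((featureLaw Sig s).prod (gaussianReal 0 (σ ^ 2))).map
    (fun ze => (ze.1, (∑ j, ze.1 (Sum.inl j) * β j) + ze.2))

/-- The law of `n` independent observations. -/
def dataLaw (n : ℕ) {p : ℕ} (Sig : Matrix (Fin p) (Fin p) ℝ) (s : Fin p → ℝ) (σ : ℝ≥0)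
    (β : Fin p → ℝ) : Measure (Fin n → EuclideanSpace ℝ (Fin p ⊕ Fin p) × ℝ) :=
  Measure.pi (fun _ => obsLaw Sig s σ β)

/-- The `n × 2p` matrix of the observed features and knockoffs. -/
def design {n p : ℕ} (D : Fin n → EuclideanSpace ℝ (Fin p ⊕ Fin p) × ℝ) :
    Matrix (Fin n) (Fin p ⊕ Fin p) ℝ :=
  Matrix.of (fun i k => (D i).1 k)

/-- The vector of the observed responses. -/
def response {n p : ℕ} (D : Fin n → EuclideanSpace ℝ (Fin p ⊕ Fin p) × ℝ) : Fin n → ℝ :=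
  fun i => (D i).2

/-- The ordinary least squares coefficients `(Zᵀ Z)⁻¹ Zᵀ y` (zero when `Zᵀ Z` is singular). -/
def olsCoef {n p : ℕ} (Z : Matrix (Fin n) (Fin p ⊕ Fin p) ℝ) (y : Fin n → ℝ) :
    Fin p ⊕ Fin p → ℝ :=
  (Zᵀ * Z)⁻¹ *ᵥ (Zᵀ *ᵥ y)

/-- The absolute coefficient difference statistics of ordinary least squares. -/
def olsStat {n p : ℕ} (Z : Matrix (Fin n) (Fin p ⊕ Fin p) ℝ) (y : Fin n → ℝ) : Fin p → ℝ :=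
  fun j => |olsCoef Z y (Sum.inl j)| - |olsCoef Z y (Sum.inr j)|

open Classical in
/-- The data-dependent threshold: the least `t` among the nonzero values of the `|W_j|` such that
`(#{j | W_j ≤ -t} + 1) / #{j | W_j ≥ t} ≤ q`, and `⊤` if there is none. The inequality is written
without division, so that it fails when `#{j | W_j ≥ t} = 0`. -/
def threshold {p : ℕ} (q : ℝ) (W : Fin p → ℝ) : WithTop ℝ :=
  ((Finset.univ.image (fun j => |W j|)).filter (fun t => t ≠ 0 ∧
    ((Finset.univ.filter (fun j => W j ≤ -t)).card : ℝ) + 1 ≤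
      q * ((Finset.univ.filter (fun j => t ≤ W j)).card : ℝ))).min

open Classical in
/-- The set of features selected at level `q`. -/
def selected {p : ℕ} (q : ℝ) (W : Fin p → ℝ) : Finset (Fin p) :=
  Finset.univ.filter (fun j => threshold q W ≤ ((W j : ℝ) : WithTop ℝ))

open Classical in
/-- The set of the non-null features. -/
def nonNulls {p : ℕ} (β : Fin p → ℝ) : Finset (Fin p) :=
  Finset.univ.filter (fun j => β j ≠ 0)

/-- The average power, at level `q`, of the feature statistic `w` for the fixed coefficients `β`:
the expected number of selected non-nulls over the number of non-nulls. -/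
def power {n p : ℕ} (Sig : Matrix (Fin p) (Fin p) ℝ) (s : Fin p → ℝ) (σ : ℝ≥0) (q : ℝ)
    (w : Matrix (Fin n) (Fin p ⊕ Fin p) ℝ → (Fin n → ℝ) → Fin p → ℝ) (β : Fin p → ℝ) : ℝ :=
  (∫ D, ((selected q (w (design D) (response D)) ∩ nonNulls β).card : ℝ)
    ∂(dataLaw n Sig s σ β)) / ((nonNulls β).card : ℝ)

/-- The law of the random coefficients: a uniformly drawn set of `k` of the `p` coordinates is
filled with a uniform point of the `k`-dimensional hypercube of side length `b` centered at `0`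
(equivalently, with independent uniform entries); the other coordinates are `0`. -/
def coefLaw (p k : ℕ) (b : ℝ) : Measure (Fin p → ℝ) :=
  ((Finset.univ.powersetCard k : Finset (Finset (Fin p))).card : ℝ≥0∞)⁻¹ •
    ∑ J ∈ (Finset.univ.powersetCard k : Finset (Finset (Fin p))),
      Measure.pi (fun j => if j ∈ J then (volume[|Set.Icc (-(b / 2)) (b / 2)] : Measure ℝ)
        else Measure.dirac 0)

end

end Knockoff

namespace Knockoff

/-! ### Inverse moments of the squared norm of a standard Gaussian vector -/

/-! The response is a linear model in all `2p` columns `Z` with true coefficients `(β, 0)`, so the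
OLS error is `(ZᵀZ)⁻¹Zᵀξ`, which does not involve `β`. Hence, uniformly in `β`, `E ∑ (W_j - |β_j|)²
≤ 2σ² E tr (ZᵀZ)⁻¹`, and two traces have to be controlled.

Random part: write `Z = W Lᵀ` with `W` standard Gaussian, `L Lᵀ = G` and `Lᵀ L` diagonal. Then `tr
(ZᵀZ)⁻¹` is a combination of the diagonal entries of `(WᵀW)⁻¹`. Each of these is the inverse squared
distance from a column to the span of the others, an inverse chi-square, with mean at most `1/(n -
2p - 1)` (`lintegral_gram_inv_diag_le`). A ridge term avoids assuming invertibility, and the same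
bound yields full rank almost surely.

Deterministic part: for positive definite `G` the MVR loss is exactly `tr G⁻¹ / 2`. The choice `S =
γI` is feasible with `G_S ≽ γI`, so minimality gives `tr G⁻¹ ≤ 2p/γ` (`IsMVR.posDef_and_trace_le`);
finiteness of the loss also forces `G` to be positive definite. Altogether the error is of order
`p/n → 0`, and Markov's inequality gives the first claim.

Power: if every `W_j` is within `τ` of `|β_j|`, no `W_j` is as low as `-τ`, so the threshold lies
below every coefficient of size at least `2τ` as soon as there are `1/q` of them
(`strongSignals_subset_selected`). A uniform coefficient is smaller than `2τ` with probability
`O(τ/b)`, so by Markov's inequality nearly all the non-nulls are that large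
(`coefLaw_not_strongSignals_le`). -/

lemma integral_exp_neg_mul_sq_gaussianReal {t : ℝ} (ht : 0 ≤ t) :
    ∫ x, Real.exp (-(t * x ^ 2)) ∂(gaussianReal 0 1) = (1 + 2 * t) ^ (-(1 / 2) : ℝ) := by
  rw [integral_gaussianReal_eq_integral_smul one_ne_zero]
  have h : ∀ x : ℝ, gaussianPDFReal 0 1 x • Real.exp (-(t * x ^ 2))
      = (√(2 * Real.pi))⁻¹ * Real.exp (-(t + 1 / 2) * x ^ 2) := by
    intro x
    simp only [gaussianPDFReal, NNReal.coe_one, mul_one, sub_zero, smul_eq_mul]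
    rw [mul_assoc, ← Real.exp_add]
    congr 2
    ring
  simp_rw [h]
  rw [integral_const_mul, integral_gaussian, ← Real.sqrt_inv, ← Real.sqrt_mul (by positivity),
    Real.rpow_neg (by positivity), ← Real.sqrt_eq_rpow, ← Real.sqrt_inv]
  congr 1
  have := Real.pi_pos
  field_simp
  ring

lemma lintegral_exp_neg_mul_normSq_stdGaussian (F : Type*) [NormedAddCommGroup F]
    [InnerProductSpace ℝ F] [FiniteDimensional ℝ F] [MeasurableSpace F] [BorelSpace F]
    {t : ℝ} (ht : 0 ≤ t) :
    ∫⁻ x, ENNReal.ofReal (Real.exp (-(t * ‖x‖ ^ 2))) ∂(stdGaussian F) =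
      ENNReal.ofReal ((1 + 2 * t) ^ (-((Module.finrank ℝ F : ℝ) / 2))) := by
  have hint : Integrable (fun x : F => Real.exp (-(t * ‖x‖ ^ 2))) (stdGaussian F) := by
    refine Integrable.of_bound (C := 1) (by fun_prop) (ae_of_all _ fun x => ?_)
    rw [Real.norm_eq_abs, Real.abs_exp, Real.exp_le_one_iff]
    have : 0 ≤ t * ‖x‖ ^ 2 := by positivity
    linarith
  rw [← ofReal_integral_eq_lintegral_ofReal hint (ae_of_all _ fun x => (Real.exp_pos _).le)]
  congr 1
  rw [stdGaussian, integral_map (Measurable.aemeasurable (by fun_prop))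
    (Measurable.aestronglyMeasurable (by fun_prop))]
  have h : ∀ x : Fin (Module.finrank ℝ F) → ℝ,
      Real.exp (-(t * ‖∑ i, x i • stdOrthonormalBasis ℝ F i‖ ^ 2))
        = ∏ i, Real.exp (-(t * x i ^ 2)) := by
    intro x
    rw [← Real.exp_sum, Finset.sum_neg_distrib, ← Finset.mul_sum, ← real_inner_self_eq_norm_sq,
      (stdOrthonormalBasis ℝ F).orthonormal.inner_sum]
    simp [sq]
  simp_rw [h]
  rw [integral_fintype_prod_eq_prod (f := fun _ x => Real.exp (-(t * x ^ 2)))]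
  simp_rw [integral_exp_neg_mul_sq_gaussianReal ht]
  rw [Finset.prod_const, Finset.card_univ, Fintype.card_fin, ← Real.rpow_natCast, ← Real.rpow_mul
    (by positivity)]
  congr 1
  ring

/-- This is the Laplace representation of `1/x`; at `x = 0` both sides are infinite. -/
lemma inv_ofReal_le_lintegral_exp {x : ℝ} (hx : 0 ≤ x) :
    (ENNReal.ofReal x)⁻¹ ≤ ∫⁻ t in Set.Ioi (0 : ℝ), ENNReal.ofReal (Real.exp (-(t * x))) := by
  rcases hx.eq_or_lt with rfl | hx
  · simp
  · have h1 : IntegrableOn (fun t : ℝ => Real.exp (-x * t)) (Set.Ioi 0) :=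
      integrableOn_exp_mul_Ioi (neg_lt_zero.2 hx) 0
    have h2 : ∀ t : ℝ, Real.exp (-(t * x)) = Real.exp (-x * t) := fun t => by congr 1; ring
    simp_rw [h2]
    rw [← ofReal_integral_eq_lintegral_ofReal h1 (ae_of_all _ fun x => (Real.exp_pos _).le),
      integral_exp_mul_Ioi (neg_lt_zero.2 hx), ENNReal.ofReal_inv_of_pos hx |>.symm]
    apply ENNReal.ofReal_le_ofReal
    simp [neg_div_neg_eq]

lemma lintegral_Ioi_one_add_two_mul_rpow {a : ℝ} (ha : 1 < a) :
    ∫⁻ t in Set.Ioi (0 : ℝ), ENNReal.ofReal ((1 + 2 * t) ^ (-a)) =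
      ENNReal.ofReal (1 / (2 * a - 2)) := by
  have hd : ∀ t ∈ Set.Ici (0 : ℝ),
      HasDerivAt (fun t : ℝ => -(1 + 2 * t) ^ (1 - a) / (2 * a - 2)) ((1 + 2 * t) ^ (-a)) t := by
    intro t ht
    have ht : (0 : ℝ) ≤ t := ht
    have h1 : HasDerivAt (fun t : ℝ => 1 + 2 * t) 2 t := by
      simpa using ((hasDerivAt_id t).const_mul 2).const_add 1
    have h2 := ((h1.rpow_const (p := 1 - a) (Or.inl (by positivity))).neg).div_const (2 * a - 2)
    convert! h2 using 1
    have : 2 * a - 2 ≠ 0 := by linarith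
    rw [show 1 - a - 1 = -a by ring, eq_div_iff this]
    ring
  have hpos : ∀ t ∈ Set.Ioi (0 : ℝ), 0 ≤ (1 + 2 * t) ^ (-a) := fun t ht => by
    have ht : (0 : ℝ) < t := ht
    positivity
  have hlim : Tendsto (fun t : ℝ => -(1 + 2 * t) ^ (1 - a) / (2 * a - 2)) atTop (𝓝 0) := by
    have h1 : Tendsto (fun t : ℝ => 1 + 2 * t) atTop atTop :=
      tendsto_atTop_add_const_left _ _ (tendsto_id.const_mul_atTop two_pos)
    have h2 := ((tendsto_rpow_neg_atTop (y := a - 1) (by linarith)).comp h1).neg.div_const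
      (2 * a - 2)
    simpa [Function.comp_def] using h2
  rw [← ofReal_integral_eq_lintegral_ofReal
    (integrableOn_Ioi_deriv_of_nonneg' hd hpos hlim)
    ((ae_restrict_iff' measurableSet_Ioi).2 (ae_of_all _ hpos)),
    integral_Ioi_of_hasDerivAt_of_nonneg' hd hpos hlim]
  congr 1
  simp [neg_div]

/-- Tonelli reduces the inverse moment to the integral of the Laplace transform `(1 + 2t)^(-d/2)` of
the squared norm. Dimension at least `3` makes the exponent integrable. -/
lemma lintegral_inv_normSq_stdGaussian_le (F : Type*) [NormedAddCommGroup F]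
    [InnerProductSpace ℝ F] [FiniteDimensional ℝ F] [MeasurableSpace F] [BorelSpace F]
    (hF : 3 ≤ Module.finrank ℝ F) :
    ∫⁻ x, (ENNReal.ofReal (‖x‖ ^ 2))⁻¹ ∂(stdGaussian F) ≤
      ENNReal.ofReal (1 / ((Module.finrank ℝ F : ℝ) - 2)) := by
  have hF' : (3 : ℝ) ≤ Module.finrank ℝ F := by exact_mod_cast hF
  calc ∫⁻ x, (ENNReal.ofReal (‖x‖ ^ 2))⁻¹ ∂(stdGaussian F)
      ≤ ∫⁻ x, (∫⁻ t in Set.Ioi (0 : ℝ), ENNReal.ofReal (Real.exp (-(t * ‖x‖ ^ 2))))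
          ∂(stdGaussian F) :=
        lintegral_mono fun x => inv_ofReal_le_lintegral_exp (sq_nonneg _)
    _ = ∫⁻ t in Set.Ioi (0 : ℝ), ∫⁻ x, ENNReal.ofReal (Real.exp (-(t * ‖x‖ ^ 2)))
          ∂(stdGaussian F) := by
        apply lintegral_lintegral_swap
        apply Measurable.aemeasurable
        unfold Function.uncurry
        fun_prop
    _ = ∫⁻ t in Set.Ioi (0 : ℝ),
          ENNReal.ofReal ((1 + 2 * t) ^ (-((Module.finrank ℝ F : ℝ) / 2))) :=
        setLIntegral_congr_fun measurableSet_Ioi fun t ht =>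
          lintegral_exp_neg_mul_normSq_stdGaussian F (le_of_lt ht)
    _ = ENNReal.ofReal (1 / ((Module.finrank ℝ F : ℝ) - 2)) := by
        rw [lintegral_Ioi_one_add_two_mul_rpow (by linarith)]
        congr 3
        ring

/-- The image of the standard Gaussian law under an orthogonal projection is standard Gaussian. -/
lemma stdGaussian_map_orthogonalProjectionOnto {E : Type*} [NormedAddCommGroup E]
    [InnerProductSpace ℝ E] [FiniteDimensional ℝ E] [MeasurableSpace E] [BorelSpace E]
    (K : Submodule ℝ E) :
    (stdGaussian E).map K.orthogonalProjectionOnto = stdGaussian K := by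
  apply Measure.ext_of_charFun
  ext t
  rw [charFun_stdGaussian, charFun_apply, integral_map (by fun_prop) (by fun_prop)]
  have h : ∀ x : E, inner ℝ (K.orthogonalProjectionOnto x) t = inner ℝ x (t : E) := fun x =>
    Submodule.inner_orthogonalProjectionOnto_eq_of_mem_right t x
  simp_rw [h]
  rw [← charFun_apply, charFun_stdGaussian]
  simp

lemma lintegral_inv_normSq_orthogonalProjection_le {E : Type*} [NormedAddCommGroup E]
    [InnerProductSpace ℝ E] [FiniteDimensional ℝ E] [MeasurableSpace E] [BorelSpace E]
    (K : Submodule ℝ E) {m : ℕ} (hK : Module.finrank ℝ K + m ≤ Module.finrank ℝ E) (hm : 3 ≤ m) :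
    ∫⁻ x, (ENNReal.ofReal (‖Kᗮ.orthogonalProjectionOnto x‖ ^ 2))⁻¹ ∂(stdGaussian E) ≤
      ENNReal.ofReal (1 / ((m : ℝ) - 2)) := by
  have hd : m ≤ Module.finrank ℝ Kᗮ := by
    have := K.finrank_add_finrank_orthogonal
    omega
  have hm' : (3 : ℝ) ≤ m := by exact_mod_cast hm
  have hd' : (m : ℝ) ≤ Module.finrank ℝ Kᗮ := by exact_mod_cast hd
  calc ∫⁻ x, (ENNReal.ofReal (‖Kᗮ.orthogonalProjectionOnto x‖ ^ 2))⁻¹ ∂(stdGaussian E)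
      = ∫⁻ y, (ENNReal.ofReal (‖y‖ ^ 2))⁻¹ ∂((stdGaussian E).map Kᗮ.orthogonalProjectionOnto) := by
        rw [lintegral_map (by fun_prop) (by fun_prop)]
    _ ≤ ENNReal.ofReal (1 / ((Module.finrank ℝ Kᗮ : ℝ) - 2)) := by
        rw [stdGaussian_map_orthogonalProjectionOnto]
        exact lintegral_inv_normSq_stdGaussian_le _ (hm.trans hd)
    _ ≤ ENNReal.ofReal (1 / ((m : ℝ) - 2)) := by
        apply ENNReal.ofReal_le_ofReal
        apply one_div_le_one_div_of_le <;> linarith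

/-! ### Ridge-regularized inverse Gram matrices -/

section Ridge

variable {N ι : Type*} [Fintype N] [Fintype ι] [DecidableEq ι]

/-- The inverse of the Gram matrix of the columns of `Z`, regularized by `ε`. -/
noncomputable def ridgeInv (Z : Matrix N ι ℝ) (ε : ℝ) : Matrix ι ι ℝ :=
  (Zᵀ * Z + ε • (1 : Matrix ι ι ℝ))⁻¹

lemma posDef_gram_add_smul_one (Z : Matrix N ι ℝ) {ε : ℝ} (hε : 0 < ε) :
    (Zᵀ * Z + ε • (1 : Matrix ι ι ℝ)).PosDef := by
  have h1 : (Zᵀ * Z).PosSemidef := by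
    simpa [Matrix.conjTranspose_eq_transpose_of_trivial] using
      Matrix.posSemidef_conjTranspose_mul_self Z
  exact Matrix.PosDef.posSemidef_add h1 (Matrix.PosDef.one.smul hε)

lemma gram_add_smul_one_mulVec_ridgeInv_col (Z : Matrix N ι ℝ) {ε : ℝ} (hε : 0 < ε) (j : ι) :
    (Zᵀ * Z + ε • (1 : Matrix ι ι ℝ)) *ᵥ (ridgeInv Z ε).col j = Pi.single j 1 := by
  have h := (posDef_gram_add_smul_one Z hε).isUnit
  rw [← Matrix.mulVec_single_one, Matrix.mulVec_mulVec, ridgeInv,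
    Matrix.mul_nonsing_inv _ ((Matrix.isUnit_iff_isUnit_det _).1 h), Matrix.one_mulVec]

/-- Pair the equation `(ZᵀZ + ε) a = e_j` with its solution `a`, the `j`-th column of the inverse.
-/
lemma ridgeInv_diag_eq (Z : Matrix N ι ℝ) {ε : ℝ} (hε : 0 < ε) (j : ι) :
    ridgeInv Z ε j j = (Z *ᵥ (ridgeInv Z ε).col j) ⬝ᵥ (Z *ᵥ (ridgeInv Z ε).col j) +
      ε * ((ridgeInv Z ε).col j ⬝ᵥ (ridgeInv Z ε).col j) := by
  have h := congrArg (fun v => (ridgeInv Z ε).col j ⬝ᵥ v)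
    (gram_add_smul_one_mulVec_ridgeInv_col Z hε j)
  simp only [dotProduct_single, mul_one, Matrix.col_apply] at h
  rw [← h, Matrix.add_mulVec, dotProduct_add, Matrix.smul_mulVec, Matrix.one_mulVec,
    dotProduct_smul, smul_eq_mul, ← Matrix.mulVec_mulVec, Matrix.dotProduct_mulVec,
    Matrix.vecMul_transpose]

lemma dotProduct_self_nonneg' {κ : Type*} [Fintype κ] (v : κ → ℝ) : 0 ≤ v ⬝ᵥ v :=
  Finset.sum_nonneg fun i _ => mul_self_nonneg (v i)

lemma ridgeInv_diag_nonneg (Z : Matrix N ι ℝ) {ε : ℝ} (hε : 0 < ε) (j : ι) :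
    0 ≤ ridgeInv Z ε j j := by
  rw [ridgeInv_diag_eq Z hε j]
  have := dotProduct_self_nonneg' (Z *ᵥ (ridgeInv Z ε).col j)
  have := dotProduct_self_nonneg' ((ridgeInv Z ε).col j)
  positivity

/-- The span of all the columns of `Z` but the `j`-th. -/
def spanOtherCols (Z : Matrix N ι ℝ) (j : ι) : Submodule ℝ (EuclideanSpace ℝ N) :=
  Submodule.span ℝ (Set.range fun i : {i : ι // i ≠ j} => WithLp.toLp 2 (Z.col i))

lemma finrank_spanOtherCols_le {N ι : Type*} [Fintype ι] [DecidableEq ι] (Z : Matrix N ι ℝ)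
    (j : ι) :
    Module.finrank ℝ (spanOtherCols Z j) + 1 ≤ Fintype.card ι := by
  have h : Module.finrank ℝ (spanOtherCols Z j) ≤ Fintype.card {i : ι // i ≠ j} :=
    finrank_range_le_card _
  have h2 : Fintype.card {i : ι // i ≠ j} = Fintype.card ι - 1 := by
    simp
  have h3 : 0 < Fintype.card ι := Fintype.card_pos_iff.2 ⟨j⟩
  omega

/-- Without the ridge term and for full rank this is the Schur complement identity: the diagonal
entry is the inverse squared distance from the column to the span of the others. The ridge can only
decrease it. -/
lemma ridgeInv_diag_mul_le_one (Z : Matrix N ι ℝ) {ε : ℝ} (hε : 0 < ε) (j : ι) :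
    ridgeInv Z ε j j *
      ‖(spanOtherCols Z j)ᗮ.orthogonalProjectionOnto (WithLp.toLp 2 (Z.col j))‖ ^ 2 ≤ 1 := by
  set P := (spanOtherCols Z j)ᗮ.orthogonalProjectionOnto with hP
  set a := (ridgeInv Z ε).col j with ha
  have haj : ridgeInv Z ε j j = a j := rfl
  have h0 := ridgeInv_diag_nonneg Z hε j
  have hsum : (WithLp.toLp 2 (Z *ᵥ a) : EuclideanSpace ℝ N)
      = ∑ i, a i • WithLp.toLp 2 (Z.col i) := by
    ext k
    simp [Matrix.mulVec, dotProduct, mul_comm]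
  -- The projection kills every column but the `j`-th.
  have hproj : P (WithLp.toLp 2 (Z *ᵥ a)) = a j • P (WithLp.toLp 2 (Z.col j)) := by
    rw [hsum, map_sum, Finset.sum_eq_single j]
    · simp
    · intro i _ hij
      rw [map_smul, hP, Submodule.orthogonalProjectionOnto_eq_zero_iff.2, smul_zero]
      apply Submodule.le_orthogonal_orthogonal
      exact Submodule.subset_span ⟨⟨i, hij⟩, rfl⟩
    · simp
  have hle : ‖P (WithLp.toLp 2 (Z *ᵥ a))‖ ≤ ‖(WithLp.toLp 2 (Z *ᵥ a) : EuclideanSpace ℝ N)‖ :=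
    Submodule.norm_orthogonalProjectionOnto_apply_le _ _
  have hle2 : ‖P (WithLp.toLp 2 (Z *ᵥ a))‖ ^ 2 ≤ a j := by
    calc ‖P (WithLp.toLp 2 (Z *ᵥ a))‖ ^ 2
        ≤ ‖(WithLp.toLp 2 (Z *ᵥ a) : EuclideanSpace ℝ N)‖ ^ 2 := by gcongr
      _ = (Z *ᵥ a) ⬝ᵥ (Z *ᵥ a) := by
          rw [EuclideanSpace.real_norm_sq_eq]
          simp [dotProduct, sq]
      _ ≤ a j := by
          rw [← haj, ridgeInv_diag_eq Z hε j]
          have := dotProduct_self_nonneg' a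
          have : 0 ≤ ε * (a ⬝ᵥ a) := by positivity
          linarith
  -- This reads `a_j² ‖P z_j‖² ≤ a_j`; it remains to divide by `a_j`, if nonzero.
  rw [hproj, norm_smul, mul_pow, Real.norm_eq_abs, sq_abs] at hle2
  rw [haj] at h0 ⊢
  rcases h0.eq_or_lt with h | h
  · simp [← h]
  · rw [sq, mul_assoc] at hle2
    nlinarith

lemma ofReal_ridgeInv_diag_le (Z : Matrix N ι ℝ) {ε : ℝ} (hε : 0 < ε) (j : ι) :
    ENNReal.ofReal (ridgeInv Z ε j j) ≤ (ENNReal.ofReal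
      (‖(spanOtherCols Z j)ᗮ.orthogonalProjectionOnto (WithLp.toLp 2 (Z.col j))‖ ^ 2))⁻¹ := by
  rw [ENNReal.le_inv_iff_mul_le, ← ENNReal.ofReal_mul (ridgeInv_diag_nonneg Z hε j)]
  exact ENNReal.ofReal_le_one.2 (ridgeInv_diag_mul_le_one Z hε j)

/-- On the kernel of `ZᵀZ` the regularized inverse acts as `1/ε`, so its trace is at least `1/ε`.
Bounded expected diagonal entries therefore make singularity a null event. -/
lemma one_le_mul_sum_ridgeInv_diag (Z : Matrix N ι ℝ) (hZ : (Zᵀ * Z).det = 0) {ε : ℝ}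
    (hε : 0 < ε) : 1 ≤ ε * ∑ j, ridgeInv Z ε j j := by
  obtain ⟨v, hv, hv0⟩ := Matrix.exists_mulVec_eq_zero_iff.2 hZ
  have hvv : 0 < v ⬝ᵥ v := by
    refine lt_of_le_of_ne (dotProduct_self_nonneg' v) fun h => hv ?_
    exact dotProduct_self_eq_zero.1 h.symm
  -- Pairing the kernel vector `v` with the equation for the column `a` gives `v_j = ε ⟨a, v⟩`; then
  -- Cauchy–Schwarz and `ε ‖a‖² ≤ a_j`.
  have hj : ∀ j, v j ^ 2 ≤ ε * ridgeInv Z ε j j * (v ⬝ᵥ v) := by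
    intro j
    set a := (ridgeInv Z ε).col j with ha
    have h1 : v j = ε * (a ⬝ᵥ v) := by
      have h := congrArg (fun u => v ⬝ᵥ u) (gram_add_smul_one_mulVec_ridgeInv_col Z hε j)
      simp only [dotProduct_single, mul_one] at h
      have hsymm : (Zᵀ * Z + ε • (1 : Matrix ι ι ℝ))ᵀ = Zᵀ * Z + ε • (1 : Matrix ι ι ℝ) := by
        simp
      rw [← h, Matrix.dotProduct_mulVec, ← Matrix.mulVec_transpose, hsymm, Matrix.add_mulVec, hv0,
        Matrix.smul_mulVec, Matrix.one_mulVec, zero_add, smul_dotProduct, smul_eq_mul,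
        dotProduct_comm]
    have h2 : (a ⬝ᵥ v) ^ 2 ≤ (a ⬝ᵥ a) * (v ⬝ᵥ v) := by
      have := Finset.sum_mul_sq_le_sq_mul_sq Finset.univ a v
      simpa [dotProduct, sq] using this
    have h3 : ε * (a ⬝ᵥ a) ≤ ridgeInv Z ε j j := by
      rw [ridgeInv_diag_eq Z hε j]
      have := dotProduct_self_nonneg' (Z *ᵥ a)
      linarith
    calc v j ^ 2 = ε ^ 2 * (a ⬝ᵥ v) ^ 2 := by rw [h1]; ring
      _ ≤ ε ^ 2 * ((a ⬝ᵥ a) * (v ⬝ᵥ v)) := by gcongr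
      _ = ε * (ε * (a ⬝ᵥ a)) * (v ⬝ᵥ v) := by ring
      _ ≤ _ := by gcongr
  have hsum : v ⬝ᵥ v ≤ (ε * ∑ j, ridgeInv Z ε j j) * (v ⬝ᵥ v) := by
    calc v ⬝ᵥ v = ∑ j, v j ^ 2 := by simp [dotProduct, sq]
      _ ≤ ∑ j, ε * ridgeInv Z ε j j * (v ⬝ᵥ v) := Finset.sum_le_sum fun j _ => hj j
      _ = _ := by rw [Finset.mul_sum, Finset.sum_mul]
  by_contra! h
  nlinarith

lemma tendsto_ridgeInv (Z : Matrix N ι ℝ) (hZ : (Zᵀ * Z).det ≠ 0) :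
    Tendsto (fun ε : ℝ => ridgeInv Z ε) (𝓝 0) (𝓝 (Zᵀ * Z)⁻¹) := by
  have hc : Continuous fun ε : ℝ => Zᵀ * Z + ε • (1 : Matrix ι ι ℝ) := by fun_prop
  have h1 : ContinuousAt (fun A : Matrix ι ι ℝ => A⁻¹) (Zᵀ * Z) := by
    apply continuousAt_matrix_inv
    rw [Ring.inverse_eq_inv']
    exact continuousAt_inv₀ hZ
  have h2 : Tendsto (fun ε : ℝ => Zᵀ * Z + ε • (1 : Matrix ι ι ℝ)) (𝓝 0) (𝓝 (Zᵀ * Z)) := by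
    simpa using hc.tendsto 0
  exact h1.tendsto.comp h2

end Ridge

lemma measurable_matrix_inv {α κ : Type*} [MeasurableSpace α] [Fintype κ] [DecidableEq κ]
    {A : α → Matrix κ κ ℝ} (hA : ∀ i j, Measurable fun x => A x i j) (i j : κ) :
    Measurable fun x => (A x)⁻¹ i j := by
  have hA' : Measurable fun x (p : κ × κ) => A x p.1 p.2 := by
    rw [measurable_pi_iff]
    exact fun p => hA p.1 p.2
  have hdet : Continuous fun (f : κ × κ → ℝ) => (Matrix.of fun i j => f (i, j)).det :=
    Continuous.matrix_det (continuous_matrix fun i j => continuous_apply (i, j))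
  have hadj : Continuous fun (f : κ × κ → ℝ) =>
      (Matrix.of fun i j => f (i, j)).adjugate i j :=
    (Continuous.matrix_adjugate
      (continuous_matrix fun i j => continuous_apply (i, j))).matrix_elem i j
  have h1 := hdet.measurable.comp hA'
  have h2 := hadj.measurable.comp hA'
  have : (fun x => (A x)⁻¹ i j) = fun x => ((A x).det)⁻¹ * (A x).adjugate i j := by
    ext x
    rw [Matrix.inv_def, Ring.inverse_eq_inv', Matrix.smul_apply, smul_eq_mul]
  rw [this]
  exact h1.inv.mul h2

/-! ### Expected inverse Gram matrices of Gaussian matrices -/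

section Wishart

variable (N ι : Type*) [Fintype N] [Fintype ι]

/-- The law of a matrix with independent standard Gaussian entries. -/
noncomputable def gaussianMatrix : Measure (N → ι → ℝ) :=
  Measure.pi fun _ => Measure.pi fun _ => gaussianReal 0 1

instance : IsProbabilityMeasure (gaussianMatrix N ι) := by
  unfold gaussianMatrix; infer_instance

variable {N ι} [DecidableEq ι]

lemma pi_prod_map_update {X : Type*} [MeasurableSpace X] (μ : Measure X) [IsProbabilityMeasure μ]
    (j : ι) :
    ((Measure.pi fun _ : ι => μ).prod μ).map (fun x => Function.update x.1 j x.2) =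
      Measure.pi fun _ : ι => μ := by
  have hmeas : Measurable fun x : (ι → X) × X => Function.update x.1 j x.2 := by
    rw [measurable_pi_iff]
    intro i
    by_cases h : i = j
    · subst h; simpa using measurable_snd
    · simp only [Function.update_of_ne h]; fun_prop
  refine (Measure.pi_eq fun s hs => ?_).symm
  rw [Measure.map_apply hmeas (MeasurableSet.univ_pi hs)]
  have : (fun x : (ι → X) × X => Function.update x.1 j x.2) ⁻¹' Set.univ.pi s =
      (Set.univ.pi (Function.update s j Set.univ)) ×ˢ s j := by
    ext x
    simp only [Set.mem_preimage, Set.mem_pi, Set.mem_univ, true_imp_iff, Set.mem_prod]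
    constructor
    · intro h
      refine ⟨fun i => ?_, by simpa using h j⟩
      by_cases hi : i = j
      · subst hi; simp
      · simpa [Function.update_of_ne hi] using h i
    · rintro ⟨h1, h2⟩ i
      by_cases hi : i = j
      · subst hi; simpa using h2
      · simpa [Function.update_of_ne hi] using h1 i
  rw [this, Measure.prod_prod, Measure.pi_pi, ← Finset.mul_prod_erase _ _ (Finset.mem_univ j),
    ← Finset.mul_prod_erase _ (fun i => μ (s i)) (Finset.mem_univ j)]
  simp only [Function.update_self, measure_univ, one_mul]
  rw [mul_comm]
  congr 1
  refine Finset.prod_congr rfl fun i hi => ?_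
  rw [Function.update_of_ne (Finset.ne_of_mem_erase hi)]

/-- Resampling a column of a Gaussian matrix does not change its law. -/
lemma gaussianMatrix_map_update (j : ι) :
    ((gaussianMatrix N ι).prod (Measure.pi fun _ : N => gaussianReal 0 1)).map
      (fun x i => Function.update (x.1 i) j (x.2 i)) = gaussianMatrix N ι := by
  have hrow : Measurable fun x : (ι → ℝ) × ℝ => Function.update x.1 j x.2 := by
    rw [measurable_pi_iff]
    intro i
    by_cases h : i = j
    · subst h; simpa using measurable_snd
    · simp only [Function.update_of_ne h]; fun_prop
  have h1 := (measurePreserving_arrowProdEquivProdArrow (ι → ℝ) ℝ N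
    (fun _ => Measure.pi fun _ : ι => gaussianReal 0 1) (fun _ => gaussianReal 0 1)).symm
  unfold gaussianMatrix
  have h2 : (fun (x : (N → ι → ℝ) × (N → ℝ)) i => Function.update (x.1 i) j (x.2 i)) =
      (fun (x : N → (ι → ℝ) × ℝ) i => Function.update (x i).1 j (x i).2) ∘
        (MeasurableEquiv.arrowProdEquivProdArrow (ι → ℝ) ℝ N).symm := rfl
  have h3 : Measurable fun (x : N → (ι → ℝ) × ℝ) i => Function.update (x i).1 j (x i).2 := by
    rw [measurable_pi_iff]
    exact fun i => hrow.comp (measurable_pi_apply i)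
  rw [h2, ← Measure.map_map h3 h1.measurable, h1.map_eq]
  have : ∀ _ : N, SigmaFinite (((Measure.pi fun _ : ι => gaussianReal 0 1).prod
      (gaussianReal 0 1)).map fun x : (ι → ℝ) × ℝ => Function.update x.1 j x.2) := fun _ => by
    rw [pi_prod_map_update]; infer_instance
  rw [Measure.pi_map_pi (f := fun _ (x : (ι → ℝ) × ℝ) => Function.update x.1 j x.2)
    (fun _ => hrow.aemeasurable)]
  simp_rw [pi_prod_map_update]

lemma measurable_gram_apply {N ι : Type*} [Fintype N] (i j : ι) :
    Measurable fun W : N → ι → ℝ => ((Matrix.of W)ᵀ * Matrix.of W) i j := by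
  simp only [Matrix.mul_apply, Matrix.transpose_apply, Matrix.of_apply]
  fun_prop

lemma measurable_ridgeInv_apply (ε : ℝ) (i j : ι) :
    Measurable fun W : N → ι → ℝ => ridgeInv (Matrix.of W) ε i j := by
  refine measurable_matrix_inv (fun i j => ?_) i j
  exact (measurable_gram_apply i j).add_const _

/-- Resample column `j` independently: with the other columns fixed, their span is a fixed subspace,
and the projection of the fresh column onto its complement is standard Gaussian there. The bound is
uniform in `ε`. -/
lemma lintegral_ridgeInv_diag_le (hN : Fintype.card ι + 2 ≤ Fintype.card N) {ε : ℝ} (hε : 0 < ε)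
    (j : ι) :
    ∫⁻ W, ENNReal.ofReal (ridgeInv (Matrix.of W) ε j j) ∂(gaussianMatrix N ι) ≤
      ENNReal.ofReal (1 / ((Fintype.card N : ℝ) - Fintype.card ι - 1)) := by
  have hm : Measurable fun W : N → ι → ℝ => ENNReal.ofReal (ridgeInv (Matrix.of W) ε j j) :=
    (measurable_ridgeInv_apply ε j j).ennreal_ofReal
  have hu : Measurable fun (x : (N → ι → ℝ) × (N → ℝ)) i => Function.update (x.1 i) j (x.2 i) := by
    rw [measurable_pi_iff]
    intro k
    rw [measurable_pi_iff]
    intro i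
    by_cases h : i = j
    · subst h; simp only [Function.update_self]; fun_prop
    · simp only [Function.update_of_ne h]; fun_prop
  have hcard : 0 < Fintype.card ι := Fintype.card_pos_iff.2 ⟨j⟩
  rw [← gaussianMatrix_map_update j, lintegral_map hm hu, lintegral_prod _ (by exact (hm.comp hu).aemeasurable)]
  have key : ∀ W : N → ι → ℝ,
      ∫⁻ g, ENNReal.ofReal (ridgeInv
        (Matrix.of fun i => Function.update (W i) j (g i)) ε j j)
          ∂(Measure.pi fun _ : N => gaussianReal 0 1) ≤
      ENNReal.ofReal (1 / ((Fintype.card N : ℝ) - Fintype.card ι - 1)) := by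
    intro W
    set K := spanOtherCols (Matrix.of W) j with hK
    have hKU : ∀ g : N → ℝ,
        spanOtherCols (Matrix.of fun i => Function.update (W i) j (g i)) j = K := by
      intro g
      simp only [hK, spanOtherCols]
      congr 2
      ext i k
      simp [Function.update_of_ne i.2]
    have hcol : ∀ g : N → ℝ,
        (Matrix.of fun i => Function.update (W i) j (g i)).col j = g := by
      intro g; ext k; simp
    have hpt : ∀ g : N → ℝ, ENNReal.ofReal (ridgeInv
        (Matrix.of fun i => Function.update (W i) j (g i)) ε j j) ≤
        (ENNReal.ofReal (‖Kᗮ.orthogonalProjectionOnto (WithLp.toLp 2 g)‖ ^ 2))⁻¹ := by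
      intro g
      have h := ofReal_ridgeInv_diag_le
        (Matrix.of fun i => Function.update (W i) j (g i)) hε j
      rwa [hKU, hcol] at h
    refine (lintegral_mono hpt).trans ?_
    have hmap := lintegral_map (μ := Measure.pi fun _ : N => gaussianReal 0 1)
      (f := fun x : EuclideanSpace ℝ N =>
        (ENNReal.ofReal (‖Kᗮ.orthogonalProjectionOnto x‖ ^ 2))⁻¹)
      (g := WithLp.toLp 2) (by fun_prop) (by fun_prop)
    rw [← hmap, map_pi_eq_stdGaussian]
    have hd : Module.finrank ℝ K + 1 ≤ Fintype.card ι :=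
      finrank_spanOtherCols_le (Matrix.of W) j
    -- The `card ι - 1` other columns leave a complement of dimension at least `m = card N - card ι
    -- + 1`, and `hN` is exactly `m ≥ 3`.
    refine (lintegral_inv_normSq_orthogonalProjection_le K
      (m := Fintype.card N + 1 - Fintype.card ι) ?_ (by omega)).trans_eq ?_
    · rw [finrank_euclideanSpace]; omega
    · rw [Nat.cast_sub (by omega)]
      push_cast
      congr 2
      ring
  refine (lintegral_mono key).trans ?_
  simp

/-- A tall Gaussian matrix almost surely has full rank. -/
lemma ae_det_gram_ne_zero (hN : Fintype.card ι + 2 ≤ Fintype.card N) :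
    ∀ᵐ W ∂(gaussianMatrix N ι), ((Matrix.of W)ᵀ * Matrix.of W).det ≠ 0 := by
  set C : ℝ≥0∞ := ∑ _j : ι, ENNReal.ofReal (1 / ((Fintype.card N : ℝ) - Fintype.card ι - 1))
    with hC
  have hCtop : C ≠ ⊤ := ENNReal.sum_ne_top.2 fun _ _ => ENNReal.ofReal_ne_top
  -- Markov's inequality for `ε` times the trace of the regularized inverse, whose mean is `O(ε)`.
  have hbound : ∀ k : ℕ, gaussianMatrix N ι {W | ((Matrix.of W)ᵀ * Matrix.of W).det = 0} ≤
      ENNReal.ofReal (1 / ((k : ℝ) + 1)) * C := by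
    intro k
    have hk : (0 : ℝ) < 1 / ((k : ℝ) + 1) := by positivity
    set ε : ℝ := 1 / ((k : ℝ) + 1)
    have hmeas : ∀ j, Measurable fun W : N → ι → ℝ =>
        ENNReal.ofReal (ridgeInv (Matrix.of W) ε j j) :=
      fun j => (measurable_ridgeInv_apply ε j j).ennreal_ofReal
    have hmeas' : Measurable fun W : N → ι → ℝ =>
        ENNReal.ofReal ε * ∑ j, ENNReal.ofReal (ridgeInv (Matrix.of W) ε j j) :=
      (Finset.measurable_fun_sum _ fun j _ => hmeas j).const_mul _
    calc gaussianMatrix N ι {W | ((Matrix.of W)ᵀ * Matrix.of W).det = 0}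
        ≤ gaussianMatrix N ι {W | 1 ≤
            ENNReal.ofReal ε * ∑ j, ENNReal.ofReal (ridgeInv (Matrix.of W) ε j j)} := by
          refine measure_mono fun W hW => ?_
          have h := one_le_mul_sum_ridgeInv_diag (Matrix.of W) hW hk
          rw [Set.mem_ofPred_eq, ← ENNReal.ofReal_sum_of_nonneg
            (fun j _ => ridgeInv_diag_nonneg _ hk j), ← ENNReal.ofReal_mul hk.le]
          exact ENNReal.one_le_ofReal.2 h
      _ ≤ ∫⁻ W, ENNReal.ofReal ε * ∑ j, ENNReal.ofReal (ridgeInv (Matrix.of W) ε j j)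
            ∂(gaussianMatrix N ι) := by
          simpa using mul_meas_ge_le_lintegral (μ := gaussianMatrix N ι) hmeas' 1
      _ = ENNReal.ofReal ε * ∑ j, ∫⁻ W, ENNReal.ofReal (ridgeInv (Matrix.of W) ε j j)
            ∂(gaussianMatrix N ι) := by
          rw [lintegral_const_mul _ (Finset.measurable_fun_sum _ fun j _ => hmeas j),
            lintegral_finsetSum _ fun j _ => hmeas j]
      _ ≤ ENNReal.ofReal ε * C := by
          exact mul_le_mul_right
            (Finset.sum_le_sum fun j _ => lintegral_ridgeInv_diag_le hN hk j) _
  have hlim : Tendsto (fun k : ℕ => ENNReal.ofReal (1 / ((k : ℝ) + 1)) * C) atTop (𝓝 0) := by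
    have h1 := (ENNReal.continuous_ofReal.tendsto 0).comp
      (tendsto_one_div_add_atTop_nhds_zero_nat (𝕜 := ℝ))
    have h2 := ENNReal.Tendsto.mul_const (b := C) h1 (Or.inr hCtop)
    simpa using h2
  have h0 : gaussianMatrix N ι {W | ((Matrix.of W)ᵀ * Matrix.of W).det = 0} = 0 :=
    le_antisymm (ge_of_tendsto' hlim hbound) zero_le
  rw [ae_iff]
  simpa using h0

/-- The expected diagonal entries of the inverse Gram matrix of a tall Gaussian matrix. -/
lemma lintegral_gram_inv_diag_le (hN : Fintype.card ι + 2 ≤ Fintype.card N) (j : ι) :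
    ∫⁻ W, ENNReal.ofReal (((Matrix.of W)ᵀ * Matrix.of W)⁻¹ j j) ∂(gaussianMatrix N ι) ≤
      ENNReal.ofReal (1 / ((Fintype.card N : ℝ) - Fintype.card ι - 1)) := by
  set ε : ℕ → ℝ := fun k => 1 / ((k : ℝ) + 1) with hε
  have hpos : ∀ k, 0 < ε k := fun k => by positivity
  have hlim : Tendsto ε atTop (𝓝 0) := tendsto_one_div_add_atTop_nhds_zero_nat
  -- Fatou's lemma as the ridge vanishes, using almost sure full rank for the pointwise limit.
  calc ∫⁻ W, ENNReal.ofReal (((Matrix.of W)ᵀ * Matrix.of W)⁻¹ j j) ∂(gaussianMatrix N ι)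
      = ∫⁻ W, liminf (fun k => ENNReal.ofReal (ridgeInv (Matrix.of W) (ε k) j j)) atTop
          ∂(gaussianMatrix N ι) := by
        refine lintegral_congr_ae ?_
        filter_upwards [ae_det_gram_ne_zero hN] with W hW
        have h1 := (tendsto_ridgeInv (Matrix.of W) hW).comp hlim
        have h2 : Tendsto (fun k => ridgeInv (Matrix.of W) (ε k) j j) atTop
            (𝓝 (((Matrix.of W)ᵀ * Matrix.of W)⁻¹ j j)) :=
          ((continuous_id.matrix_elem j j).tendsto _).comp h1
        exact ((ENNReal.continuous_ofReal.tendsto _).comp h2).liminf_eq.symm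
    _ ≤ liminf (fun k => ∫⁻ W, ENNReal.ofReal (ridgeInv (Matrix.of W) (ε k) j j)
          ∂(gaussianMatrix N ι)) atTop :=
        lintegral_liminf_le fun k => (measurable_ridgeInv_apply (ε k) j j).ennreal_ofReal
    _ ≤ ENNReal.ofReal (1 / ((Fintype.card N : ℝ) - Fintype.card ι - 1)) := by
        refine (liminf_le_liminf (v := fun _ =>
          ENNReal.ofReal (1 / ((Fintype.card N : ℝ) - Fintype.card ι - 1)))
          (Eventually.of_forall fun k => lintegral_ridgeInv_diag_le hN (hpos k) j)).trans_eq ?_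
        simp

end Wishart

/-! ### Gaussian designs -/

section Factor

variable {ι : Type*} [Fintype ι] [DecidableEq ι]

/-- Take `L = U √Λ` from the spectral decomposition. Having `LᵀL` diagonal means that only diagonal
entries of the inverse Wishart matrix enter the trace below. -/
lemma exists_factor_of_posDef {G : Matrix ι ι ℝ} (hG : G.PosDef) :
    ∃ (L : Matrix ι ι ℝ) (d : ι → ℝ), (∀ i, 0 < d i) ∧ L * Lᵀ = G ∧
      Lᵀ * L = Matrix.diagonal d := by
  set U : Matrix ι ι ℝ := (hG.1.eigenvectorUnitary : Matrix ι ι ℝ) with hU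
  have hUU : Uᵀ * U = 1 := by
    have := Unitary.coe_star_mul_self hG.1.eigenvectorUnitary
    simpa [Matrix.star_eq_conjTranspose] using this
  set r : ι → ℝ := fun i => √(hG.1.eigenvalues i) with hr
  have hrr : Matrix.diagonal r * Matrix.diagonal r = Matrix.diagonal hG.1.eigenvalues := by
    rw [Matrix.diagonal_mul_diagonal]
    congr 1
    ext i
    exact Real.mul_self_sqrt (hG.eigenvalues_pos i).le
  have hspec : G = U * Matrix.diagonal hG.1.eigenvalues * Uᵀ := by
    have := hG.1.spectral_theorem
    rw [Unitary.conjStarAlgAut_apply] at this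
    simpa [Matrix.star_eq_conjTranspose, Function.comp_def] using this
  refine ⟨U * Matrix.diagonal r, hG.1.eigenvalues, hG.eigenvalues_pos, ?_, ?_⟩
  · rw [Matrix.transpose_mul, Matrix.diagonal_transpose, Matrix.mul_assoc,
      ← Matrix.mul_assoc (Matrix.diagonal r), hrr, ← Matrix.mul_assoc]
    exact hspec.symm
  · rw [Matrix.transpose_mul, Matrix.diagonal_transpose, Matrix.mul_assoc, ← Matrix.mul_assoc Uᵀ,
      hUU, Matrix.one_mul, hrr]

lemma multivariateGaussian_zero_eq_map (L : Matrix ι ι ℝ) :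
    multivariateGaussian 0 (L * Lᵀ) =
      (Measure.pi fun _ : ι => gaussianReal 0 1).map (fun w => WithLp.toLp 2 (L *ᵥ w)) := by
  have hG : (L * Lᵀ).PosSemidef := by
    simpa [Matrix.conjTranspose_eq_transpose_of_trivial] using
      Matrix.posSemidef_self_mul_conjTranspose L
  have h1 : (fun w : ι → ℝ => (WithLp.toLp 2 (L *ᵥ w) : EuclideanSpace ℝ ι)) =
      (Matrix.toEuclideanCLM (n := ι) (𝕜 := ℝ) L) ∘ WithLp.toLp 2 := rfl
  rw [h1, ← Measure.map_map (by fun_prop) (by fun_prop), map_pi_eq_stdGaussian]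
  apply Measure.ext_of_charFun
  ext t
  rw [charFun_multivariateGaussian hG, charFun_apply, integral_map (by fun_prop) (by fun_prop)]
  have h2 : ∀ x : EuclideanSpace ℝ ι, inner ℝ (Matrix.toEuclideanCLM (n := ι) (𝕜 := ℝ) L x) t =
      inner ℝ x (Matrix.toEuclideanCLM (n := ι) (𝕜 := ℝ) Lᵀ t) := by
    intro x
    rw [real_inner_comm, Matrix.inner_toEuclideanCLM, Matrix.inner_toEuclideanCLM,
      Matrix.dotProduct_mulVec, ← Matrix.mulVec_transpose, dotProduct_comm]
  simp_rw [h2]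
  rw [← charFun_apply, charFun_stdGaussian]
  congr 1
  rw [← Complex.ofReal_pow, ← real_inner_self_eq_norm_sq, Matrix.inner_toEuclideanCLM,
    Matrix.ofLp_toEuclideanCLM, ← Matrix.mulVec_mulVec, Matrix.dotProduct_mulVec,
    ← Matrix.mulVec_transpose]
  simp [neg_div]

/-- The Gram matrix is `L (WᵀW) Lᵀ`; by cyclicity of the trace, the outer factors of its inverse
combine into `(LᵀL)⁻¹`. -/
lemma trace_gram_inv_of_factor {N : Type*} [Fintype N] (W : Matrix N ι ℝ) {L : Matrix ι ι ℝ}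
    {d : ι → ℝ} (hd : ∀ i, 0 < d i) (hL : Lᵀ * L = Matrix.diagonal d) :
    (((W * Lᵀ)ᵀ * (W * Lᵀ))⁻¹).trace = ∑ j, (d j)⁻¹ * (Wᵀ * W)⁻¹ j j := by
  have h1 : (W * Lᵀ)ᵀ * (W * Lᵀ) = L * (Wᵀ * W) * Lᵀ := by
    rw [Matrix.transpose_mul, Matrix.transpose_transpose]
    simp only [Matrix.mul_assoc]
  have h2 : (Matrix.diagonal d)⁻¹ = Matrix.diagonal fun i => (d i)⁻¹ := by
    refine Matrix.inv_eq_right_inv ?_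
    rw [Matrix.diagonal_mul_diagonal, ← Matrix.diagonal_one]
    congr 1
    ext i
    exact mul_inv_cancel₀ (hd i).ne'
  rw [h1, Matrix.mul_inv_rev, Matrix.mul_inv_rev, ← Matrix.mul_assoc, Matrix.trace_mul_comm,
    ← Matrix.mul_assoc, ← Matrix.mul_inv_rev, hL, h2]
  simp only [Matrix.trace, Matrix.diag_apply, Matrix.diagonal_mul]

lemma trace_inv_of_factor {G L : Matrix ι ι ℝ} {d : ι → ℝ} (hd : ∀ i, 0 < d i)
    (hG : L * Lᵀ = G) (hL : Lᵀ * L = Matrix.diagonal d) : G⁻¹.trace = ∑ j, (d j)⁻¹ := by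
  have h := trace_gram_inv_of_factor (1 : Matrix ι ι ℝ) hd hL
  simpa [hG] using h

end Factor

/-! ### Second moments of linear images of Gaussian noise -/

lemma integrable_sq_sum_mul_pi_gaussianReal {N : Type*} [Fintype N] (v : ℝ≥0) (b : N → ℝ) :
    Integrable (fun x : N → ℝ => (∑ i, b i * x i) ^ 2)
      (Measure.pi fun _ : N => gaussianReal 0 v) := by
  refine MemLp.integrable_sq (memLp_finsetSum _ fun i _ => MemLp.const_mul ?_ _)
  exact (memLp_id_gaussianReal' 2 (by simp)).comp_measurePreserving
    (measurePreserving_eval (fun _ : N => gaussianReal 0 v) i)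

lemma integral_sq_sum_mul_pi_gaussianReal {N : Type*} [Fintype N] (v : ℝ≥0) (b : N → ℝ) :
    ∫ x, (∑ i, b i * x i) ^ 2 ∂(Measure.pi fun _ : N => gaussianReal 0 v) =
      v * ∑ i, b i ^ 2 := by
  have hmem : ∀ i : N, MemLp (fun x : ℝ => b i * x) 2 (gaussianReal 0 v) := fun i =>
    (memLp_id_gaussianReal' 2 (by simp)).const_mul _
  have hint : ∀ i : N, Integrable (fun x : N → ℝ => b i * x i)
      (Measure.pi fun _ : N => gaussianReal 0 v) := fun i => by
    exact ((hmem i).comp_measurePreserving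
      (measurePreserving_eval (fun _ : N => gaussianReal 0 v) i)).integrable (by norm_num)
  have hmean : ∫ x, (∑ i, b i * x i) ∂(Measure.pi fun _ : N => gaussianReal 0 v) = 0 := by
    rw [integral_finsetSum _ fun i _ => hint i]
    refine Finset.sum_eq_zero fun i _ => ?_
    rw [integral_comp_eval (μ := fun _ : N => gaussianReal 0 v) (f := fun x : ℝ => b i * x)
      (by fun_prop), integral_const_mul]
    simp
  have h := variance_sum_pi (μ := fun _ : N => gaussianReal 0 v) (X := fun i x => b i * x) hmem
  rw [← variance_of_integral_eq_zero (Finset.measurable_fun_sum _ fun i _ => by fun_prop).aemeasurable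
    hmean]
  have he : (fun x : N → ℝ => ∑ i, b i * x i) = ∑ i, fun x : N → ℝ => b i * x i := by
    ext x; simp
  rw [he, h]
  have hv : ∀ i, Var[fun x : ℝ => b i * x; gaussianReal 0 v] = b i ^ 2 * v := fun i => by
    rw [variance_const_mul, variance_fun_id_gaussianReal]
  simp_rw [hv]
  rw [Finset.mul_sum]
  exact Finset.sum_congr rfl fun i _ => mul_comm _ _

/-- The expected squared norm of a linear image of a Gaussian noise vector. -/
lemma lintegral_normSq_mulVec_pi_gaussianReal {N κ : Type*} [Fintype N] [Fintype κ] (v : ℝ≥0)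
    (B : Matrix κ N ℝ) :
    ∫⁻ x, ENNReal.ofReal (∑ k, (B *ᵥ x) k ^ 2) ∂(Measure.pi fun _ : N => gaussianReal 0 v) =
      ENNReal.ofReal (v * (B * Bᵀ).trace) := by
  have hint : Integrable (fun x : N → ℝ => ∑ k, (B *ᵥ x) k ^ 2)
      (Measure.pi fun _ : N => gaussianReal 0 v) :=
    integrable_finsetSum _ fun k _ => integrable_sq_sum_mul_pi_gaussianReal v (B k)
  rw [← ofReal_integral_eq_lintegral_ofReal hint
    (ae_of_all _ fun x => Finset.sum_nonneg fun k _ => sq_nonneg _),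
    integral_finsetSum (f := fun k (x : N → ℝ) => (B *ᵥ x) k ^ 2) _
      fun k _ => integrable_sq_sum_mul_pi_gaussianReal v (B k)]
  simp_rw [Matrix.mulVec, dotProduct, integral_sq_sum_mul_pi_gaussianReal]
  congr 1
  rw [← Finset.mul_sum]
  simp [Matrix.trace, Matrix.mul_apply, sq]

/-! ### The error of the ordinary least squares statistics -/

lemma olsCoef_eq_add {n p : ℕ} (Z : Matrix (Fin n) (Fin p ⊕ Fin p) ℝ) (hZ : (Zᵀ * Z).det ≠ 0)
    (c : Fin p ⊕ Fin p → ℝ) (ξ : Fin n → ℝ) :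
    olsCoef Z (Z *ᵥ c + ξ) = c + ((Zᵀ * Z)⁻¹ * Zᵀ) *ᵥ ξ := by
  unfold olsCoef
  rw [Matrix.mulVec_add, Matrix.mulVec_add, Matrix.mulVec_mulVec _ Zᵀ Z, Matrix.mulVec_mulVec,
    Matrix.nonsing_inv_mul _ (Ne.isUnit hZ), Matrix.one_mulVec, Matrix.mulVec_mulVec]

lemma pinv_mul_transpose_pinv {N ι : Type*} [Fintype N] [Fintype ι] [DecidableEq ι]
    (Z : Matrix N ι ℝ) (hZ : (Zᵀ * Z).det ≠ 0) :
    ((Zᵀ * Z)⁻¹ * Zᵀ) * ((Zᵀ * Z)⁻¹ * Zᵀ)ᵀ = (Zᵀ * Z)⁻¹ := by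
  have h : ((Zᵀ * Z)⁻¹)ᵀ = (Zᵀ * Z)⁻¹ := by
    rw [Matrix.transpose_nonsing_inv, Matrix.transpose_mul, Matrix.transpose_transpose]
  rw [Matrix.transpose_mul, Matrix.transpose_transpose, h, Matrix.mul_assoc,
    ← Matrix.mul_assoc Zᵀ, Matrix.mul_nonsing_inv _ (Ne.isUnit hZ), Matrix.mul_one]

lemma sq_abs_sub_abs_sub_abs_le (b u v : ℝ) :
    (|b + u| - |v| - |b|) ^ 2 ≤ 2 * (u ^ 2 + v ^ 2) := by
  have h1 : |(|b + u| - |b|)| ≤ |u| := by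
    simpa using abs_abs_sub_abs_le_abs_sub (b + u) b
  have h2 : (|b + u| - |b|) ^ 2 ≤ u ^ 2 := sq_le_sq.2 h1
  have h3 : |v| ^ 2 = v ^ 2 := sq_abs v
  nlinarith [sq_nonneg (|b + u| - |b| + |v|)]

/-- Each feature and its knockoff contribute the errors of their two OLS coefficients, estimating
`β_j` and `0`. The right-hand side is free of `β`, whence the uniformity. -/
lemma sum_sq_olsStat_sub_le {n p : ℕ} (Z : Matrix (Fin n) (Fin p ⊕ Fin p) ℝ)
    (hZ : (Zᵀ * Z).det ≠ 0) (β : Fin p → ℝ) (ξ : Fin n → ℝ) :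
    ∑ j, (olsStat Z (Z *ᵥ Sum.elim β 0 + ξ) j - |β j|) ^ 2 ≤
      2 * ∑ k, (((Zᵀ * Z)⁻¹ * Zᵀ) *ᵥ ξ) k ^ 2 := by
  unfold olsStat
  rw [olsCoef_eq_add Z hZ, Fintype.sum_sum_type, ← Finset.sum_add_distrib, Finset.mul_sum]
  refine Finset.sum_le_sum fun j _ => ?_
  simpa using sq_abs_sub_abs_sub_abs_le (β j) _ _

section Measurability

variable {n p : ℕ}

lemma measurable_olsCoef (k : Fin p ⊕ Fin p) :
    Measurable fun D : Fin n → EuclideanSpace ℝ (Fin p ⊕ Fin p) × ℝ =>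
      olsCoef (design D) (response D) k := by
  have hd : ∀ i k, Measurable fun D : Fin n → EuclideanSpace ℝ (Fin p ⊕ Fin p) × ℝ =>
      design D i k := fun i k => by
    unfold design
    simp only [Matrix.of_apply]
    fun_prop
  have hr : ∀ i, Measurable fun D : Fin n → EuclideanSpace ℝ (Fin p ⊕ Fin p) × ℝ =>
      response D i := fun i => by
    unfold response
    fun_prop
  have hg : ∀ k l, Measurable fun D : Fin n → EuclideanSpace ℝ (Fin p ⊕ Fin p) × ℝ =>
      ((design D)ᵀ * design D) k l := fun k l => by
    simp only [Matrix.mul_apply, Matrix.transpose_apply]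
    exact Finset.measurable_fun_sum _ fun i _ => (hd i k).mul (hd i l)
  unfold olsCoef
  simp only [Matrix.mulVec, dotProduct, Matrix.transpose_apply]
  exact Finset.measurable_fun_sum _ fun l _ => (measurable_matrix_inv hg k l).mul
    (Finset.measurable_fun_sum _ fun i _ => (hd i l).mul (hr i))

lemma measurable_olsStat (j : Fin p) :
    Measurable fun D : Fin n → EuclideanSpace ℝ (Fin p ⊕ Fin p) × ℝ =>
      olsStat (design D) (response D) j := by
  unfold olsStat
  exact (measurable_olsCoef _).abs.sub (measurable_olsCoef _).abs

lemma measurable_sum_sq_olsStat_sub (β : Fin p → ℝ) :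
    Measurable fun D : Fin n → EuclideanSpace ℝ (Fin p ⊕ Fin p) × ℝ =>
      ∑ j, (olsStat (design D) (response D) j - |β j|) ^ 2 :=
  Finset.measurable_fun_sum _ fun j _ => ((measurable_olsStat j).sub_const _).pow_const 2

end Measurability

/-! ### The data as an image of independent Gaussian variables, and the mean squared error -/

section DataLaw

variable {n p : ℕ}

/-- The data built from a matrix of standard Gaussian variables and a noise vector. -/
noncomputable def dataOfNoise (L : Matrix (Fin p ⊕ Fin p) (Fin p ⊕ Fin p) ℝ) (β : Fin p → ℝ)
    (x : (Fin n → Fin p ⊕ Fin p → ℝ) × (Fin n → ℝ)) :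
    Fin n → EuclideanSpace ℝ (Fin p ⊕ Fin p) × ℝ :=
  fun i => (WithLp.toLp 2 (L *ᵥ x.1 i), ∑ j, (L *ᵥ x.1 i) (Sum.inl j) * β j + x.2 i)

lemma design_dataOfNoise (L : Matrix (Fin p ⊕ Fin p) (Fin p ⊕ Fin p) ℝ) (β : Fin p → ℝ)
    (x : (Fin n → Fin p ⊕ Fin p → ℝ) × (Fin n → ℝ)) :
    design (dataOfNoise L β x) = Matrix.of x.1 * Lᵀ := by
  ext i k
  simp [design, dataOfNoise, Matrix.mulVec, dotProduct, Matrix.mul_apply, mul_comm]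

lemma response_dataOfNoise (L : Matrix (Fin p ⊕ Fin p) (Fin p ⊕ Fin p) ℝ) (β : Fin p → ℝ)
    (x : (Fin n → Fin p ⊕ Fin p → ℝ) × (Fin n → ℝ)) :
    response (dataOfNoise L β x) = (Matrix.of x.1 * Lᵀ) *ᵥ Sum.elim β 0 + x.2 := by
  rw [← design_dataOfNoise L β x]
  ext i
  simp [response, design, dataOfNoise, Matrix.mulVec, dotProduct]

lemma measurable_obsOfNoise (L : Matrix (Fin p ⊕ Fin p) (Fin p ⊕ Fin p) ℝ) (β : Fin p → ℝ) :
    Measurable fun x : (Fin p ⊕ Fin p → ℝ) × ℝ =>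
      ((WithLp.toLp 2 (L *ᵥ x.1) : EuclideanSpace ℝ (Fin p ⊕ Fin p)),
        ∑ j, (L *ᵥ x.1) (Sum.inl j) * β j + x.2) := by
  have hL : Continuous fun w : Fin p ⊕ Fin p → ℝ => L *ᵥ w :=
    continuous_const.matrix_mulVec continuous_id
  have hLk : ∀ k, Continuous fun w : Fin p ⊕ Fin p → ℝ => (L *ᵥ w) k := fun k =>
    (continuous_apply k).comp hL
  refine Measurable.prodMk ?_ ?_
  · exact ((PiLp.continuous_toLp 2 _).comp (hL.comp continuous_fst)).measurable
  · refine Continuous.measurable ?_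
    refine Continuous.add (continuous_finsetSum _ fun j _ => ?_) continuous_snd
    exact ((hLk _).comp continuous_fst).mul continuous_const

lemma measurable_dataOfNoise (L : Matrix (Fin p ⊕ Fin p) (Fin p ⊕ Fin p) ℝ) (β : Fin p → ℝ) :
    Measurable (dataOfNoise (n := n) L β) := by
  rw [measurable_pi_iff]
  intro i
  have h : Measurable fun x : (Fin n → Fin p ⊕ Fin p → ℝ) × (Fin n → ℝ) => (x.1 i, x.2 i) := by
    fun_prop
  exact (measurable_obsOfNoise L β).comp h

variable {Sig : Matrix (Fin p) (Fin p) ℝ} {s : Fin p → ℝ}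

instance (Sig : Matrix (Fin p) (Fin p) ℝ) (s : Fin p → ℝ) :
    IsProbabilityMeasure (featureLaw Sig s) := by
  unfold featureLaw; infer_instance

lemma obsLaw_eq_map {L : Matrix (Fin p ⊕ Fin p) (Fin p ⊕ Fin p) ℝ}
    (hL : L * Lᵀ = jointCov Sig s) (σ : ℝ≥0) (β : Fin p → ℝ) :
    obsLaw Sig s σ β =
      ((Measure.pi fun _ : Fin p ⊕ Fin p => gaussianReal 0 1).prod (gaussianReal 0 (σ ^ 2))).map
        fun x => ((WithLp.toLp 2 (L *ᵥ x.1) : EuclideanSpace ℝ (Fin p ⊕ Fin p)),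
          ∑ j, (L *ᵥ x.1) (Sum.inl j) * β j + x.2) := by
  have hLm : Measurable fun w : Fin p ⊕ Fin p → ℝ =>
      (WithLp.toLp 2 (L *ᵥ w) : EuclideanSpace ℝ (Fin p ⊕ Fin p)) :=
    ((PiLp.continuous_toLp 2 _).comp
      (continuous_const.matrix_mulVec continuous_id)).measurable
  unfold obsLaw featureLaw
  rw [← hL, multivariateGaussian_zero_eq_map]
  conv_lhs => rw [← Measure.map_id (μ := gaussianReal 0 (σ ^ 2))]
  rw [Measure.map_prod_map _ _ hLm measurable_id, Measure.map_map (by fun_prop)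
    (hLm.prodMap measurable_id)]
  rfl

lemma dataLaw_eq_map {L : Matrix (Fin p ⊕ Fin p) (Fin p ⊕ Fin p) ℝ}
    (hL : L * Lᵀ = jointCov Sig s) (σ : ℝ≥0) (β : Fin p → ℝ) :
    dataLaw n Sig s σ β =
      ((gaussianMatrix (Fin n) (Fin p ⊕ Fin p)).prod
        (Measure.pi fun _ : Fin n => gaussianReal 0 (σ ^ 2))).map (dataOfNoise L β) := by
  have hobs := measurable_obsOfNoise L β
  have h1 := (measurePreserving_arrowProdEquivProdArrow (Fin p ⊕ Fin p → ℝ) ℝ (Fin n)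
    (fun _ => Measure.pi fun _ : Fin p ⊕ Fin p => gaussianReal 0 1)
    (fun _ => gaussianReal 0 (σ ^ 2)))
  unfold gaussianMatrix dataLaw
  rw [← h1.map_eq, Measure.map_map (measurable_dataOfNoise L β) h1.measurable]
  simp_rw [obsLaw_eq_map hL]
  have : ∀ _ : Fin n, IsProbabilityMeasure
      (((Measure.pi fun _ : Fin p ⊕ Fin p => gaussianReal 0 1).prod (gaussianReal 0 (σ ^ 2))).map
        fun x => ((WithLp.toLp 2 (L *ᵥ x.1) : EuclideanSpace ℝ (Fin p ⊕ Fin p)),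
          ∑ j, (L *ᵥ x.1) (Sum.inl j) * β j + x.2)) := fun _ =>
    Measure.isProbabilityMeasure_map hobs.aemeasurable
  rw [← Measure.pi_map_pi fun _ => hobs.aemeasurable]
  rfl

instance (σ : ℝ≥0) (β : Fin p → ℝ) : IsProbabilityMeasure (obsLaw Sig s σ β) := by
  unfold obsLaw
  exact Measure.isProbabilityMeasure_map (by fun_prop)

instance (σ : ℝ≥0) (β : Fin p → ℝ) : IsProbabilityMeasure (dataLaw n Sig s σ β) := by
  unfold dataLaw; infer_instance

/-- Average over the noise first, with the design fixed: this leaves `2σ² tr (ZᵀZ)⁻¹`. Then average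
over the design. -/
lemma lintegral_sum_sq_olsStat_sub_le (hG : (jointCov Sig s).PosDef) (hn : 2 * p + 2 ≤ n)
    (σ : ℝ≥0) (β : Fin p → ℝ) :
    ∫⁻ D, ENNReal.ofReal (∑ j, (olsStat (design D) (response D) j - |β j|) ^ 2)
        ∂(dataLaw n Sig s σ β) ≤
      ENNReal.ofReal (2 * σ ^ 2 * (jointCov Sig s)⁻¹.trace / ((n : ℝ) - 2 * p - 1)) := by
  obtain ⟨L, d, hd, hLG, hLd⟩ := exists_factor_of_posDef hG
  have hLdet : L.det ≠ 0 := by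
    have h := hG.det_pos
    rw [← hLG, Matrix.det_mul] at h
    exact left_ne_zero_of_mul h.ne'
  have hcard : Fintype.card (Fin p ⊕ Fin p) + 2 ≤ Fintype.card (Fin n) := by
    simp; omega
  have hmeas := (measurable_sum_sq_olsStat_sub (n := n) β).ennreal_ofReal
  rw [dataLaw_eq_map hLG, lintegral_map hmeas (measurable_dataOfNoise L β),
    lintegral_prod _ (by exact (hmeas.comp (measurable_dataOfNoise L β)).aemeasurable)]
  have hinner : ∀ᵐ W ∂(gaussianMatrix (Fin n) (Fin p ⊕ Fin p)),
      ∫⁻ ξ, ENNReal.ofReal (∑ j, (olsStat (design (dataOfNoise L β (W, ξ)))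
        (response (dataOfNoise L β (W, ξ))) j - |β j|) ^ 2)
          ∂(Measure.pi fun _ : Fin n => gaussianReal 0 (σ ^ 2)) ≤
      ∑ j, ENNReal.ofReal (2 * σ ^ 2 * (d j)⁻¹) *
        ENNReal.ofReal (((Matrix.of W)ᵀ * Matrix.of W)⁻¹ j j) := by
    filter_upwards [ae_det_gram_ne_zero hcard] with W hW
    set Z : Matrix (Fin n) (Fin p ⊕ Fin p) ℝ := Matrix.of W * Lᵀ with hZ
    have hgram : Zᵀ * Z = L * ((Matrix.of W)ᵀ * Matrix.of W) * Lᵀ := by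
      rw [hZ, Matrix.transpose_mul, Matrix.transpose_transpose]
      simp only [Matrix.mul_assoc]
    have hZdet : (Zᵀ * Z).det ≠ 0 := by
      rw [hgram, Matrix.det_mul, Matrix.det_mul, Matrix.det_transpose]
      exact mul_ne_zero (mul_ne_zero hLdet hW) hLdet
    calc ∫⁻ ξ, ENNReal.ofReal (∑ j, (olsStat (design (dataOfNoise L β (W, ξ)))
            (response (dataOfNoise L β (W, ξ))) j - |β j|) ^ 2)
            ∂(Measure.pi fun _ : Fin n => gaussianReal 0 (σ ^ 2))
        ≤ ∫⁻ ξ, ENNReal.ofReal 2 *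
            ENNReal.ofReal (∑ k, (((Zᵀ * Z)⁻¹ * Zᵀ) *ᵥ ξ) k ^ 2)
            ∂(Measure.pi fun _ : Fin n => gaussianReal 0 (σ ^ 2)) := by
          refine lintegral_mono fun ξ => ?_
          rw [design_dataOfNoise, response_dataOfNoise, ← ENNReal.ofReal_mul two_pos.le]
          exact ENNReal.ofReal_le_ofReal (sum_sq_olsStat_sub_le Z hZdet β ξ)
      _ = ENNReal.ofReal (∑ j, 2 * σ ^ 2 * (d j)⁻¹ *
            ((Matrix.of W)ᵀ * Matrix.of W)⁻¹ j j) := by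
          rw [lintegral_const_mul' _ _ ENNReal.ofReal_ne_top,
            lintegral_normSq_mulVec_pi_gaussianReal, pinv_mul_transpose_pinv Z hZdet, hZ,
            trace_gram_inv_of_factor (Matrix.of W) hd hLd, ← ENNReal.ofReal_mul two_pos.le,
            Finset.mul_sum, Finset.mul_sum]
          congr 1
          refine Finset.sum_congr rfl fun j _ => ?_
          push_cast
          ring
      -- Subadditivity suffices and spares checking that the diagonal entries are nonnegative.
      _ ≤ ∑ j, ENNReal.ofReal (2 * σ ^ 2 * (d j)⁻¹ *
            ((Matrix.of W)ᵀ * Matrix.of W)⁻¹ j j) :=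
          Finset.univ.le_sum_of_subadditive ENNReal.ofReal ENNReal.ofReal_zero.le
            (fun _ _ => ENNReal.ofReal_add_le) _
      _ = _ := by
          refine Finset.sum_congr rfl fun j _ => ?_
          have := hd j
          rw [ENNReal.ofReal_mul (by positivity)]
  have hmeas' : ∀ j, Measurable fun W : Fin n → Fin p ⊕ Fin p → ℝ =>
      ENNReal.ofReal (((Matrix.of W)ᵀ * Matrix.of W)⁻¹ j j) := fun j =>
    (measurable_matrix_inv measurable_gram_apply j j).ennreal_ofReal
  have hden : (0 : ℝ) < (n : ℝ) - 2 * p - 1 := by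
    have : (2 * p + 2 : ℝ) ≤ n := by exact_mod_cast hn
    linarith
  calc _ ≤ ∫⁻ W, ∑ j, ENNReal.ofReal (2 * σ ^ 2 * (d j)⁻¹) *
        ENNReal.ofReal (((Matrix.of W)ᵀ * Matrix.of W)⁻¹ j j)
          ∂(gaussianMatrix (Fin n) (Fin p ⊕ Fin p)) := lintegral_mono_ae hinner
    _ = ∑ j, ENNReal.ofReal (2 * σ ^ 2 * (d j)⁻¹) * ∫⁻ W,
        ENNReal.ofReal (((Matrix.of W)ᵀ * Matrix.of W)⁻¹ j j)
          ∂(gaussianMatrix (Fin n) (Fin p ⊕ Fin p)) := by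
        rw [lintegral_finsetSum _ fun j _ => (hmeas' j).const_mul _]
        exact Finset.sum_congr rfl fun j _ => lintegral_const_mul _ (hmeas' j)
    _ ≤ ∑ j, ENNReal.ofReal (2 * σ ^ 2 * (d j)⁻¹) *
        ENNReal.ofReal (1 / ((n : ℝ) - 2 * p - 1)) := by
        refine Finset.sum_le_sum fun j _ => mul_le_mul_right ?_ _
        refine (lintegral_gram_inv_diag_le hcard j).trans_eq ?_
        congr 2
        simp
        ring
    _ = ENNReal.ofReal (2 * σ ^ 2 * (jointCov Sig s)⁻¹.trace / ((n : ℝ) - 2 * p - 1)) := by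
        rw [trace_inv_of_factor hd hLG hLd, Finset.mul_sum, Finset.sum_div,
          ENNReal.ofReal_sum_of_nonneg fun j _ => by have := hd j; positivity]
        refine Finset.sum_congr rfl fun j _ => ?_
        have := hd j
        rw [← ENNReal.ofReal_mul (by positivity)]
        congr 1
        ring

/-- The ordinary least squares statistics are close to the absolute coefficients with large
probability, uniformly in the coefficients. -/
lemma dataLaw_lt_sum_sq_olsStat_sub_le (hG : (jointCov Sig s).PosDef) (hn : 2 * p + 2 ≤ n)
    (σ : ℝ≥0) (β : Fin p → ℝ) {ε : ℝ} (hε : 0 < ε) :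
    dataLaw n Sig s σ β
        {D | ε < ∑ j, (olsStat (design D) (response D) j - |β j|) ^ 2} ≤
      ENNReal.ofReal (2 * σ ^ 2 * (jointCov Sig s)⁻¹.trace / ((n : ℝ) - 2 * p - 1) / ε) := by
  have hmeas := (measurable_sum_sq_olsStat_sub (n := n) β).ennreal_ofReal
  calc _ ≤ dataLaw n Sig s σ β {D | ENNReal.ofReal ε ≤
        ENNReal.ofReal (∑ j, (olsStat (design D) (response D) j - |β j|) ^ 2)} :=
        measure_mono fun D hD => ENNReal.ofReal_le_ofReal (le_of_lt hD)
    _ ≤ (∫⁻ D, ENNReal.ofReal (∑ j, (olsStat (design D) (response D) j - |β j|) ^ 2)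
        ∂(dataLaw n Sig s σ β)) / ENNReal.ofReal ε :=
        meas_ge_le_lintegral_div hmeas.aemeasurable (by simpa using hε) ENNReal.ofReal_ne_top
    _ ≤ _ := by
        rw [ENNReal.ofReal_div_of_pos hε]
        exact ENNReal.div_le_div_right (lintegral_sum_sq_olsStat_sub_le hG hn σ β) _

end DataLaw

/-! ### The loss of Gaussian knockoffs -/

section CondVar

variable {p : ℕ} {Sig : Matrix (Fin p) (Fin p) ℝ} {s : Fin p → ℝ}

lemma covariance_sum_mul_featureLaw (hG : (jointCov Sig s).PosSemidef)
    (a b : Fin p ⊕ Fin p → ℝ) :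
    cov[fun z : EuclideanSpace ℝ (Fin p ⊕ Fin p) => ∑ k, a k * z k, fun z => ∑ k, b k * z k;
      featureLaw Sig s] = a ⬝ᵥ (jointCov Sig s *ᵥ b) := by
  have h := covarianceBilin_multivariateGaussian (μ := 0) hG (WithLp.toLp 2 a) (WithLp.toLp 2 b)
  rw [covarianceBilin_apply_eq_cov IsGaussian.memLp_two_id] at h
  simpa [featureLaw, PiLp.inner_apply, mul_comm] using h

lemma covariance_sum_mul_apply_featureLaw (hG : (jointCov Sig s).PosSemidef)
    (a : Fin p ⊕ Fin p → ℝ) (k : Fin p ⊕ Fin p) :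
    cov[fun z : EuclideanSpace ℝ (Fin p ⊕ Fin p) => ∑ k, a k * z k, fun z => z k;
      featureLaw Sig s] = (jointCov Sig s *ᵥ a) k := by
  have h := covariance_sum_mul_featureLaw hG a (Pi.single k 1)
  rw [Matrix.dotProduct_mulVec, ← Matrix.mulVec_transpose, dotProduct_single, mul_one,
    show (jointCov Sig s)ᵀ = jointCov Sig s by
      simpa [Matrix.conjTranspose_eq_transpose_of_trivial] using hG.1.eq] at h
  rw [← h]
  congr 1
  ext z
  simp [Pi.single_apply]

lemma integral_sum_mul_featureLaw (a : Fin p ⊕ Fin p → ℝ) :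
    ∫ z : EuclideanSpace ℝ (Fin p ⊕ Fin p), ∑ k, a k * z k ∂(featureLaw Sig s) = 0 := by
  have h : ∀ z : EuclideanSpace ℝ (Fin p ⊕ Fin p), ∑ k, a k * z k =
      innerSL ℝ (WithLp.toLp 2 a) z := fun z => by
    simp [PiLp.inner_apply, mul_comm]
  simp_rw [h]
  unfold featureLaw
  rw [ContinuousLinearMap.integral_comp_comm _ IsGaussian.integrable_fun_id,
    integral_id_multivariateGaussian, map_zero]

lemma memLp_sum_mul_featureLaw (a : Fin p ⊕ Fin p → ℝ) :
    MemLp (fun z : EuclideanSpace ℝ (Fin p ⊕ Fin p) => ∑ k, a k * z k) 2 (featureLaw Sig s) := by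
  have h : (fun z : EuclideanSpace ℝ (Fin p ⊕ Fin p) => ∑ k, a k * z k) =
      innerSL ℝ (WithLp.toLp 2 a) ∘ id := by
    ext z
    simp [PiLp.inner_apply, mul_comm]
  rw [h]
  unfold featureLaw
  exact ((innerSL ℝ (WithLp.toLp 2 a)).comp_memLp' IsGaussian.memLp_two_id)

/-- A linear combination of the coordinates that is uncorrelated with all the coordinates but the
`j`-th is independent of them. -/
lemma indep_sum_mul_restSigma (hG : (jointCov Sig s).PosSemidef) {j : Fin p}
    {a : Fin p ⊕ Fin p → ℝ} (ha : ∀ k, k ≠ Sum.inl j → (jointCov Sig s *ᵥ a) k = 0) :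
    Indep (MeasurableSpace.comap
        (fun (z : EuclideanSpace ℝ (Fin p ⊕ Fin p)) (_ : Unit) => ∑ k, a k * z k) inferInstance)
      (restSigma j) (featureLaw Sig s) := by
  rw [← IndepFun_iff_Indep]
  refine HasGaussianLaw.indepFun_of_covariance_eval
    (X := fun (_ : Unit) (z : EuclideanSpace ℝ (Fin p ⊕ Fin p)) => ∑ k, a k * z k)
    (Y := fun (k : {k : Fin p ⊕ Fin p // k ≠ Sum.inl j})
      (z : EuclideanSpace ℝ (Fin p ⊕ Fin p)) => z k.1) ?_ ?_
  · have hid : HasGaussianLaw id (featureLaw Sig s) := by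
      unfold featureLaw; exact IsGaussian.hasGaussianLaw_id
    exact hid.map_fun
      ((ContinuousLinearMap.pi fun _ : Unit => innerSL ℝ (WithLp.toLp 2 a)).prod
        (ContinuousLinearMap.pi fun k : {k : Fin p ⊕ Fin p // k ≠ Sum.inl j} =>
          EuclideanSpace.proj k.1)) |>.congr (ae_of_all _ fun z => by
            ext <;> simp [PiLp.inner_apply, mul_comm])
  · intro _ k
    rw [covariance_sum_mul_apply_featureLaw hG a k.1, ha k.1 k.2]

/-- `R = ∑ a_k z_k` is the regression residual of `X_j`: it is uncorrelated with, hence independent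
of, the other coordinates, and `X_j - R` is a function of them. So the expected conditional variance
is `E R² = aᵀGa`. No invertibility is needed, so the degenerate case is covered too. -/
lemma expectedCondVar_eq (hG : (jointCov Sig s).PosSemidef) {j : Fin p}
    {a : Fin p ⊕ Fin p → ℝ} (haj : a (Sum.inl j) = 1)
    (ha : ∀ k, k ≠ Sum.inl j → (jointCov Sig s *ᵥ a) k = 0) :
    expectedCondVar Sig s j = (jointCov Sig s *ᵥ a) (Sum.inl j) := by
  set μ := featureLaw Sig s with hμ
  set R : EuclideanSpace ℝ (Fin p ⊕ Fin p) → ℝ := fun z => ∑ k, a k * z k with hR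
  set c : Fin p ⊕ Fin p → ℝ := Function.update a (Sum.inl j) 0 with hc
  set H : EuclideanSpace ℝ (Fin p ⊕ Fin p) → ℝ := fun z => ∑ k, c k * z k with hH
  have hRH : (fun z : EuclideanSpace ℝ (Fin p ⊕ Fin p) => z (Sum.inl j)) = R - H := by
    ext z
    simp only [hR, hH, Pi.sub_apply, ← Finset.sum_sub_distrib, ← sub_mul]
    rw [Finset.sum_eq_single (Sum.inl j)]
    · simp [hc, haj]
    · intro k _ hk
      simp [hc, Function.update_of_ne hk]
    · simp
  have hle : restSigma j ≤ (inferInstance : MeasurableSpace (EuclideanSpace ℝ (Fin p ⊕ Fin p))) :=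
    Measurable.comap_le (by fun_prop)
  have hle' : MeasurableSpace.comap
      (fun (z : EuclideanSpace ℝ (Fin p ⊕ Fin p)) (_ : Unit) => ∑ k, a k * z k) inferInstance ≤
        (inferInstance : MeasurableSpace (EuclideanSpace ℝ (Fin p ⊕ Fin p))) :=
    Measurable.comap_le (measurable_pi_iff.2 fun _ =>
      Finset.measurable_fun_sum _ fun k _ => by fun_prop)
  have hRL := memLp_sum_mul_featureLaw (Sig := Sig) (s := s) a
  have hHL := memLp_sum_mul_featureLaw (Sig := Sig) (s := s) c
  have hRint : Integrable R μ := hRL.integrable (by norm_num)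
  have hHint : Integrable H μ := hHL.integrable (by norm_num)
  have hHm : StronglyMeasurable[restSigma j] H := by
    refine Measurable.stronglyMeasurable ?_
    have hHeq : H = (fun f : {k : Fin p ⊕ Fin p // k ≠ Sum.inl j} → ℝ => ∑ k, c k.1 * f k) ∘
        (fun (z : EuclideanSpace ℝ (Fin p ⊕ Fin p))
          (k : {k : Fin p ⊕ Fin p // k ≠ Sum.inl j}) => z k.1) := by
      ext z
      simp only [hH, Function.comp_apply]
      rw [← Fintype.sum_subtype_add_sum_subtype (fun k => k ≠ Sum.inl j) fun k => c k * z k,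
        add_eq_left]
      refine Finset.sum_eq_zero fun k _ => ?_
      have hk : k.1 = Sum.inl j := not_not.1 k.2
      simp [hc, hk]
    rw [hHeq]
    exact (Finset.measurable_fun_sum _ fun k _ => by fun_prop).comp (comap_measurable _)
  have hcondR : μ[R | restSigma j] =ᵐ[μ] fun _ => 0 := by
    have h := condExp_indep_eq (f := R) hle' hle ?_ (indep_sum_mul_restSigma hG ha)
    · rw [← integral_sum_mul_featureLaw (Sig := Sig) (s := s) a]
      exact h
    · refine Measurable.stronglyMeasurable ?_
      exact (measurable_pi_apply ()).comp (comap_measurable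
        (fun (z : EuclideanSpace ℝ (Fin p ⊕ Fin p)) (_ : Unit) => ∑ k, a k * z k))
  have hcond : (fun z => (R - H) z - (μ[R - H | restSigma j]) z) =ᵐ[μ] R := by
    filter_upwards [condExp_sub hRint hHint (restSigma j), hcondR] with z h1 h2
    rw [h1, Pi.sub_apply, Pi.sub_apply, h2, condExp_of_stronglyMeasurable hle hHm hHint]
    ring
  unfold expectedCondVar condVar
  rw [hRH, integral_condExp hle]
  calc ∫ z, ((R - H - μ[R - H | restSigma j]) ^ 2) z ∂μ = ∫ z, R z ^ 2 ∂μ := by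
        refine integral_congr_ae ?_
        filter_upwards [hcond] with z hz
        simp only [Pi.pow_apply, Pi.sub_apply] at hz ⊢
        rw [hz]
    _ = cov[R, R; μ] := by
        rw [covariance_self hRL.1.aemeasurable, variance_of_integral_eq_zero hRL.1.aemeasurable
          (integral_sum_mul_featureLaw a)]
    _ = (jointCov Sig s *ᵥ a) (Sum.inl j) := by
        rw [covariance_sum_mul_featureLaw hG, dotProduct, Finset.sum_eq_single (Sum.inl j)]
        · rw [haj, one_mul]
        · intro k _ hk
          rw [ha k hk, mul_zero]
        · simp

/-- The residual coefficients are the `j`-th column of the precision matrix, normalized to have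
`j`-th entry `1`. -/
lemma expectedCondVar_of_posDef (hG : (jointCov Sig s).PosDef) (j : Fin p) :
    expectedCondVar Sig s j = ((jointCov Sig s)⁻¹ (Sum.inl j) (Sum.inl j))⁻¹ := by
  have hdiag := hG.inv.diag_pos (i := Sum.inl j)
  set t := (jointCov Sig s)⁻¹ (Sum.inl j) (Sum.inl j) with ht
  have hmul : jointCov Sig s *ᵥ (t⁻¹ • ((jointCov Sig s)⁻¹).col (Sum.inl j)) =
      t⁻¹ • Pi.single (Sum.inl j) 1 := by
    rw [Matrix.mulVec_smul, ← Matrix.mulVec_single_one, Matrix.mulVec_mulVec,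
      Matrix.mul_nonsing_inv _ (Ne.isUnit hG.det_pos.ne'), Matrix.one_mulVec]
  rw [expectedCondVar_eq hG.posSemidef (a := t⁻¹ • ((jointCov Sig s)⁻¹).col (Sum.inl j)), hmul]
  · simp
  · simp only [Pi.smul_apply, Matrix.col_apply, smul_eq_mul]
    exact inv_mul_cancel₀ hdiag.ne'
  · intro k hk
    rw [hmul]
    simp [hk]

end CondVar

/-! ### Positive definiteness and trace bound for the MVR choice -/

section MVR

variable {p : ℕ} {Sig : Matrix (Fin p) (Fin p) ℝ} {s : Fin p → ℝ}

lemma jointCov_submatrix_swap :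
    (jointCov Sig s).submatrix (Equiv.sumComm _ _) (Equiv.sumComm _ _) = jointCov Sig s := by
  ext (i | i) (j | j) <;> rfl

/-- A kernel vector with a nonzero feature coordinate reconstructs that feature exactly and makes
the loss infinite. Swapping features and knockoffs preserves `G_S`, so the knockoff coordinates
vanish as well. -/
lemma posDef_jointCov_of_mvrLoss_ne_top (hG : (jointCov Sig s).PosSemidef)
    (h : mvrLoss Sig s ≠ ⊤) : (jointCov Sig s).PosDef := by
  rw [hG.posDef_iff_isUnit, Matrix.isUnit_iff_isUnit_det, isUnit_iff_ne_zero]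
  intro hdet
  have hker : ∀ (v : Fin p ⊕ Fin p → ℝ) (j : Fin p), jointCov Sig s *ᵥ v = 0 →
      v (Sum.inl j) = 0 := by
    intro v j hv
    by_contra hvj
    have hz : jointCov Sig s *ᵥ ((v (Sum.inl j))⁻¹ • v) = 0 := by
      rw [Matrix.mulVec_smul, hv, smul_zero]
    have h0 := expectedCondVar_eq hG (j := j) (a := (v (Sum.inl j))⁻¹ • v)
      (by simp [inv_mul_cancel₀ hvj]) (fun k _ => by rw [hz]; rfl)
    rw [hz, Pi.zero_apply] at h0
    apply h
    unfold mvrLoss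
    rw [ENNReal.sum_eq_top]
    exact ⟨j, Finset.mem_univ _, by simp [h0]⟩
  obtain ⟨v, hv, hv0⟩ := Matrix.exists_mulVec_eq_zero_iff.2 hdet
  apply hv
  ext (j | j)
  · exact hker v j hv0
  · refine hker (v ∘ Equiv.sumComm _ _) j ?_
    conv_lhs => rw [← jointCov_submatrix_swap, Matrix.submatrix_mulVec_equiv]
    rw [Function.comp_assoc, Equiv.self_comp_symm, Function.comp_id, hv0]
    rfl

lemma trace_jointCov_inv :
    ((jointCov Sig s)⁻¹).trace = 2 * ∑ j, (jointCov Sig s)⁻¹ (Sum.inl j) (Sum.inl j) := by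
  have h := Matrix.inv_submatrix_equiv (jointCov Sig s) (Equiv.sumComm (Fin p) (Fin p))
    (Equiv.sumComm (Fin p) (Fin p))
  rw [jointCov_submatrix_swap] at h
  have h2 : ∀ j, (jointCov Sig s)⁻¹ (Sum.inr j) (Sum.inr j) =
      (jointCov Sig s)⁻¹ (Sum.inl j) (Sum.inl j) := fun j => by
    conv_lhs => rw [h]
    rfl
  rw [Matrix.trace, Fintype.sum_sum_type, two_mul]
  simp [h2]

lemma mvrLoss_of_posDef (hG : (jointCov Sig s).PosDef) :
    mvrLoss Sig s =
      ENNReal.ofReal (∑ j, (jointCov Sig s)⁻¹ (Sum.inl j) (Sum.inl j)) := by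
  unfold mvrLoss
  rw [ENNReal.ofReal_sum_of_nonneg fun j _ => hG.inv.diag_pos.le]
  refine Finset.sum_congr rfl fun j _ => ?_
  rw [expectedCondVar_of_posDef hG, ← ENNReal.ofReal_inv_of_pos (inv_pos.2 hG.inv.diag_pos),
    inv_inv]

lemma posSemidef_sub_smul_one (hSig : Sig.IsHermitian) {γ : ℝ}
    (hmin : ∀ i, γ ≤ hSig.eigenvalues i) : (Sig - γ • (1 : Matrix (Fin p) (Fin p) ℝ)).PosSemidef := by
  set U : Matrix (Fin p) (Fin p) ℝ := (hSig.eigenvectorUnitary : Matrix (Fin p) (Fin p) ℝ) with hU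
  have hUU : U * Uᴴ = 1 := Unitary.coe_mul_star_self hSig.eigenvectorUnitary
  have hspec : Sig = U * Matrix.diagonal hSig.eigenvalues * Uᴴ := by
    have := hSig.spectral_theorem
    rw [Unitary.conjStarAlgAut_apply] at this
    simpa [Matrix.star_eq_conjTranspose, Function.comp_def] using this
  have h : Sig - γ • (1 : Matrix (Fin p) (Fin p) ℝ) =
      U * Matrix.diagonal (fun i => hSig.eigenvalues i - γ) * Uᴴ := by
    have hd : Matrix.diagonal (fun i => hSig.eigenvalues i - γ) =
        Matrix.diagonal hSig.eigenvalues - γ • (1 : Matrix (Fin p) (Fin p) ℝ) := by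
      rw [Matrix.smul_one_eq_diagonal, Matrix.diagonal_sub]
    rw [hd, Matrix.mul_sub, Matrix.sub_mul, ← hspec, Matrix.mul_smul, Matrix.smul_mul,
      Matrix.mul_one, hUU]
  rw [h]
  exact (Matrix.PosSemidef.diagonal fun i => sub_nonneg.2 (hmin i)).mul_mul_conjTranspose_same U

/-- For `S = γI`, all four blocks of `G_S - γI` equal `Σ - γI`, so it is `[I I]ᵀ (Σ - γI) [I I]`. -/
lemma posSemidef_jointCov_const_sub (hSig : Sig.IsHermitian) {γ : ℝ}
    (hmin : ∀ i, γ ≤ hSig.eigenvalues i) :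
    (jointCov Sig (fun _ => γ) - γ • (1 : Matrix (Fin p ⊕ Fin p) (Fin p ⊕ Fin p) ℝ)).PosSemidef := by
  have h := (posSemidef_sub_smul_one hSig hmin).conjTranspose_mul_mul_same
    (Matrix.fromCols (1 : Matrix (Fin p) (Fin p) ℝ) (1 : Matrix (Fin p) (Fin p) ℝ))
  convert h using 1
  rw [Matrix.conjTranspose_fromCols_eq_fromRows_conjTranspose, Matrix.mul_assoc,
    Matrix.mul_fromCols, Matrix.fromRows_mul_fromCols]
  ext (i | i) (j | j) <;>
    simp [jointCov, Matrix.smul_apply, Matrix.one_apply, Matrix.diagonal_apply]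

/-- The inverse joint covariance matrix of the MVR knockoffs has a trace of order `p`. -/
lemma IsMVR.posDef_and_trace_le (hs : IsMVR Sig s) (hSig : Sig.IsHermitian) {γ : ℝ} (hγ : 0 < γ)
    (hmin : ∀ i, γ ≤ hSig.eigenvalues i) :
    (jointCov Sig s).PosDef ∧ ((jointCov Sig s)⁻¹).trace ≤ 2 * p / γ := by
  have hA := posSemidef_jointCov_const_sub hSig hmin
  set G := jointCov Sig (fun _ => γ) with hGdef
  have hG : G.PosDef := by
    have := Matrix.PosDef.posSemidef_add hA
      ((Matrix.PosDef.one (n := Fin p ⊕ Fin p) (R := ℝ)).smul hγ)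
    simpa using this
  -- For the `k`-th column `a` of `G⁻¹`, `G ≽ γI` gives `a_k = aᵀGa ≥ γ ‖a‖² ≥ γ a_k²`.
  have hentry : ∀ k, G⁻¹ k k ≤ 1 / γ := by
    intro k
    set a := (G⁻¹).col k with ha
    have hGa : G *ᵥ a = Pi.single k 1 := by
      rw [ha, ← Matrix.mulVec_single_one, Matrix.mulVec_mulVec,
        Matrix.mul_nonsing_inv _ (Ne.isUnit hG.det_pos.ne'), Matrix.one_mulVec]
    have h1 := hA.dotProduct_mulVec_nonneg a
    rw [Matrix.sub_mulVec, hGa, Matrix.smul_mulVec, Matrix.one_mulVec, dotProduct_sub,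
      dotProduct_smul, smul_eq_mul, dotProduct_single, mul_one] at h1
    simp only [star_trivial] at h1
    have h2 : a k ^ 2 ≤ a ⬝ᵥ a := by
      rw [dotProduct, sq]
      exact Finset.single_le_sum (f := fun i => a i * a i) (fun i _ => mul_self_nonneg _)
        (Finset.mem_univ k)
    have h3 : 0 < a k := hG.inv.diag_pos
    change a k ≤ 1 / γ
    rw [le_div_iff₀ hγ]
    nlinarith
  -- Minimality, tested against the feasible competitor `S = γI`.
  have hloss : mvrLoss Sig s ≤ ENNReal.ofReal (p / γ) := by
    refine (hs.2 _ hG.posSemidef).trans ?_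
    rw [mvrLoss_of_posDef hG]
    refine ENNReal.ofReal_le_ofReal ?_
    refine (Finset.sum_le_sum fun j _ => hentry (Sum.inl j)).trans_eq ?_
    simp [div_eq_mul_inv]
  have hGs := posDef_jointCov_of_mvrLoss_ne_top hs.1 (ne_top_of_le_ne_top ENNReal.ofReal_ne_top hloss)
  refine ⟨hGs, ?_⟩
  rw [mvrLoss_of_posDef hGs, ENNReal.ofReal_le_ofReal_iff (by positivity)] at hloss
  rw [trace_jointCov_inv, mul_div_assoc]
  linarith

end MVR

/-! ### The selected set and the power -/

section Selection

variable {p : ℕ}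

open Classical in
/-- The features whose coefficients are at least `t` in absolute value. -/
noncomputable def strongSignals (t : ℝ) (β : Fin p → ℝ) : Finset (Fin p) :=
  Finset.univ.filter fun j => t ≤ |β j|

lemma mem_strongSignals {t : ℝ} {β : Fin p → ℝ} {j : Fin p} :
    j ∈ strongSignals t β ↔ t ≤ |β j| := by
  simp [strongSignals]

lemma strongSignals_subset_nonNulls {t : ℝ} (ht : 0 < t) (β : Fin p → ℝ) :
    strongSignals t β ⊆ nonNulls β := by
  intro j hj
  rw [mem_strongSignals] at hj
  simp only [nonNulls, Finset.mem_filter_univ]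
  intro h
  rw [h, abs_zero] at hj
  linarith

/-- All `W_j` exceed `-τ`, so a threshold candidate `t ≥ τ` has no false-positive count beyond the
`+1` in the numerator. That `1` is absorbed by the number of strong signals, all of which have `W_j
≥ τ`. -/
lemma strongSignals_subset_selected {q τ : ℝ} (hτ : 0 < τ) {W β : Fin p → ℝ}
    (hW : ∀ j, |W j - (|β j|)| < τ)
    (hq : 1 ≤ q * ((strongSignals (2 * τ) β).card : ℝ)) (hq0 : 0 < q) :
    strongSignals (2 * τ) β ⊆ selected q W := by
  classical
  set A : Finset (Fin p) := Finset.univ.filter fun j => τ ≤ W j with hA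
  have hsub : strongSignals (2 * τ) β ⊆ A := by
    intro j hj
    rw [mem_strongSignals] at hj
    have := (abs_lt.1 (hW j)).1
    simp only [hA, Finset.mem_filter_univ]
    linarith
  intro j hj
  -- The smallest `W_i` that is at least `τ` is an admissible candidate lying below every strong
  -- signal.
  obtain ⟨i, hi, hmin⟩ := A.exists_min_image W ⟨j, hsub hj⟩
  have hiτ : τ ≤ W i := by simpa [hA] using hi
  have habs : |W i| = W i := abs_of_pos (hτ.trans_le hiτ)
  have hneg : (Finset.univ.filter fun j => W j ≤ -W i) = ∅ := by
    refine Finset.filter_eq_empty_iff.2 fun k _ => ?_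
    have := (abs_lt.1 (hW k)).1
    have := abs_nonneg (β k)
    linarith
  have hpos : (strongSignals (2 * τ) β).card ≤ (Finset.univ.filter fun j => W i ≤ W j).card :=
    Finset.card_le_card fun k hk => by simpa using hmin k (hsub hk)
  have hpos' : ((strongSignals (2 * τ) β).card : ℝ) ≤
      ((Finset.univ.filter fun j => W i ≤ W j).card : ℝ) := by exact_mod_cast hpos
  have hmem : W i ∈ (Finset.univ.image (fun j => |W j|)).filter (fun t => t ≠ 0 ∧
      ((Finset.univ.filter (fun j => W j ≤ -t)).card : ℝ) + 1 ≤
        q * ((Finset.univ.filter (fun j => t ≤ W j)).card : ℝ)) := by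
    refine Finset.mem_filter.2 ⟨Finset.mem_image.2 ⟨i, Finset.mem_univ _, habs⟩,
      (hτ.trans_le hiτ).ne', ?_⟩
    rw [hneg]
    simp only [Finset.card_empty, Nat.cast_zero, zero_add]
    exact hq.trans (mul_le_mul_of_nonneg_left hpos' hq0.le)
  have hthr : threshold q W ≤ ((W i : ℝ) : WithTop ℝ) := by
    unfold threshold
    convert Finset.min_le hmem
  simp only [selected, Finset.mem_filter_univ]
  exact hthr.trans (WithTop.coe_le_coe.2 (hmin j (hsub hj)))

open Classical in
-- Lying above the least admissible candidate is lying above some admissible candidate. With the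
-- counts written as sums of indicators, measurability in `W` becomes visible.
lemma mem_selected_iff {q : ℝ} {W : Fin p → ℝ} {j : Fin p} :
    j ∈ selected q W ↔ ∃ i, |W i| ≠ 0 ∧ (∑ k, (if W k ≤ -|W i| then (1 : ℝ) else 0)) + 1 ≤
      q * (∑ k, if |W i| ≤ W k then (1 : ℝ) else 0) ∧ |W i| ≤ W j := by
  simp only [selected, Finset.mem_filter_univ, ← Finset.natCast_card_filter]
  constructor
  · intro h
    obtain ⟨t, ht⟩ := WithTop.ne_top_iff_exists.1 (ne_top_of_le_ne_top WithTop.coe_ne_top h)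
    rw [← ht, WithTop.coe_le_coe] at h
    have hmem := Finset.mem_of_min ht.symm
    obtain ⟨h1, h2, h3⟩ := Finset.mem_filter.1 hmem
    obtain ⟨i, _, rfl⟩ := Finset.mem_image.1 h1
    exact ⟨i, h2, by convert h3, h⟩
  · rintro ⟨i, h2, h3, h4⟩
    refine le_trans ?_ (WithTop.coe_le_coe.2 h4)
    unfold threshold
    refine Finset.min_le (Finset.mem_filter.2
      ⟨Finset.mem_image.2 ⟨i, Finset.mem_univ _, rfl⟩, h2, by convert h3⟩)

lemma measurableSet_mem_selected {α : Type*} [MeasurableSpace α] (q : ℝ) {W : α → Fin p → ℝ}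
    (hW : ∀ j, Measurable fun x => W x j) (j : Fin p) :
    MeasurableSet {x | j ∈ selected q (W x)} := by
  classical
  simp_rw [mem_selected_iff, Set.ofPred_exists, Set.ofPred_and]
  refine MeasurableSet.iUnion fun i => ?_
  have habs : Measurable fun x => |W x i| := (hW i).abs
  refine MeasurableSet.inter (measurableSet_eq_fun habs measurable_const).compl
    (MeasurableSet.inter (measurableSet_le ?_ ?_) (measurableSet_le habs (hW j)))
  · exact (Finset.measurable_fun_sum _ fun k _ => Measurable.ite
      (measurableSet_le (hW k) habs.neg) measurable_const measurable_const).add_const _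
  · exact (Finset.measurable_fun_sum _ fun k _ => Measurable.ite
      (measurableSet_le habs (hW k)) measurable_const measurable_const).const_mul _

open Classical in
lemma measurable_card_selected_inter {α : Type*} [MeasurableSpace α] (q : ℝ) {W : α → Fin p → ℝ}
    (hW : ∀ j, Measurable fun x => W x j) (S : Finset (Fin p)) :
    Measurable fun x => ((selected q (W x) ∩ S).card : ℝ) := by
  have h : ∀ x, ((selected q (W x) ∩ S).card : ℝ) =
      ∑ j ∈ S, if j ∈ selected q (W x) then (1 : ℝ) else 0 := by
    intro x
    rw [← Finset.natCast_card_filter, Finset.inter_comm, Finset.filter_mem_eq_inter]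
  simp_rw [h]
  exact Finset.measurable_fun_sum _ fun j _ => Measurable.ite
    (measurableSet_mem_selected q hW j) measurable_const measurable_const

end Selection

section Power

variable {n p : ℕ} {Sig : Matrix (Fin p) (Fin p) ℝ} {s : Fin p → ℝ}

open Classical in
lemma integrable_card_selected_inter (σ : ℝ≥0) (q : ℝ) (β : Fin p → ℝ) :
    Integrable (fun D => ((selected q (olsStat (design D) (response D)) ∩ nonNulls β).card : ℝ))
      (dataLaw n Sig s σ β) := by
  refine Integrable.of_bound (C := (nonNulls β).card)
    (measurable_card_selected_inter q measurable_olsStat _).aestronglyMeasurable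
    (ae_of_all _ fun D => ?_)
  rw [Real.norm_eq_abs, abs_of_nonneg (Nat.cast_nonneg _)]
  exact_mod_cast Finset.card_le_card Finset.inter_subset_right

lemma power_olsStat_le_one (σ : ℝ≥0) (q : ℝ) (β : Fin p → ℝ) :
    power (n := n) Sig s σ q olsStat β ≤ 1 := by
  classical
  unfold power
  refine div_le_one_of_le₀ ?_ (Nat.cast_nonneg _)
  calc _ ≤ ∫ _, ((nonNulls β).card : ℝ) ∂(dataLaw n Sig s σ β) := by
        refine integral_mono ?_ (integrable_const _) fun D => ?_
        · convert integrable_card_selected_inter σ q β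
        · dsimp only
          exact_mod_cast Finset.card_le_card Finset.inter_subset_right
    _ = _ := by simp

/-- Off the bad event every strong signal is selected; on it the count is bounded below by zero. -/
lemma le_power_olsStat (σ : ℝ≥0) {q τ : ℝ} (hq0 : 0 < q) (hτ : 0 < τ) (β : Fin p → ℝ)
    (hq : 1 ≤ q * ((strongSignals (2 * τ) β).card : ℝ)) :
    (1 - (dataLaw n Sig s σ β).real
        {D | τ ^ 2 / 2 < ∑ j, (olsStat (design D) (response D) j - |β j|) ^ 2}) *
      ((strongSignals (2 * τ) β).card / (nonNulls β).card) ≤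
    power (n := n) Sig s σ q olsStat β := by
  classical
  set B := {D : Fin n → EuclideanSpace ℝ (Fin p ⊕ Fin p) × ℝ |
    τ ^ 2 / 2 < ∑ j, (olsStat (design D) (response D) j - |β j|) ^ 2} with hB
  have hBm : MeasurableSet B := measurableSet_lt measurable_const (measurable_sum_sq_olsStat_sub β)
  unfold power
  rw [← mul_div_assoc]
  refine div_le_div_of_nonneg_right ?_ (Nat.cast_nonneg _)
  calc _ = ∫ D, Bᶜ.indicator (fun _ => ((strongSignals (2 * τ) β).card : ℝ)) D
          ∂(dataLaw n Sig s σ β) := by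
        rw [integral_indicator_const _ hBm.compl, probReal_compl_eq_one_sub hBm, smul_eq_mul]
    _ ≤ _ := by
        refine integral_mono ((integrable_const _).indicator hBm.compl) ?_ fun D => ?_
        · convert integrable_card_selected_inter σ q β
        · by_cases hD : D ∈ Bᶜ
          · rw [Set.indicator_of_mem hD]
            have hsum : ∑ j, (olsStat (design D) (response D) j - |β j|) ^ 2 ≤ τ ^ 2 / 2 := by
              simpa [hB] using hD
            -- The level `τ² / 2` instead of `τ²` makes this strict.
            have hW : ∀ j, |olsStat (design D) (response D) j - (|β j|)| < τ := by
              intro j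
              refine abs_lt_of_sq_lt_sq ?_ hτ.le
              have h := Finset.single_le_sum
                (f := fun j => (olsStat (design D) (response D) j - |β j|) ^ 2)
                (fun i _ => sq_nonneg _) (Finset.mem_univ j)
              have : 0 < τ ^ 2 := by positivity
              linarith
            exact Nat.cast_le.2 (Finset.card_le_card (Finset.subset_inter
              (strongSignals_subset_selected hτ hW hq hq0)
              (strongSignals_subset_nonNulls (by positivity) β)))
          · rw [Set.indicator_of_notMem hD]
            exact Nat.cast_nonneg _

end Power

/-! ### The random coefficients -/

section Coefficients

variable {p : ℕ} {b : ℝ}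

lemma isProbabilityMeasure_uniform (hb : 0 < b) :
    IsProbabilityMeasure (volume[|Set.Icc (-(b / 2)) (b / 2)] : Measure ℝ) := by
  refine cond_isProbabilityMeasure_of_finite ?_ ?_
  · rw [Real.volume_Icc]
    simp; linarith
  · simp [Real.volume_Icc]

lemma uniform_abs_lt_le (hb : 0 < b) {t : ℝ} :
    (volume[|Set.Icc (-(b / 2)) (b / 2)] : Measure ℝ) {x | |x| < t} ≤
      ENNReal.ofReal (2 * t / b) := by
  rw [cond_apply measurableSet_Icc, Real.volume_Icc]
  have h1 : {x : ℝ | |x| < t} = Set.Ioo (-t) t := by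
    ext x; simp [abs_lt]
  calc _ ≤ (ENNReal.ofReal (b / 2 - -(b / 2)))⁻¹ * volume (Set.Ioo (-t) t) := by
        rw [h1]
        exact mul_le_mul_right (measure_mono Set.inter_subset_right) _
    _ = ENNReal.ofReal (2 * t / b) := by
        rw [Real.volume_Ioo, ← ENNReal.ofReal_inv_of_pos (by linarith),
          ← ENNReal.ofReal_mul (inv_nonneg.2 (by linarith))]
        congr 1
        field_simp

open Classical in
-- Markov's inequality for the number `N` of coordinates in `J` smaller than `t`: its mean is at
-- most `k · 2t/b`, and the bad event needs `N ≥ δk`.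
lemma pi_not_strongSignals_le (hb : 0 < b) {k : ℕ} (hk : 0 < k) {J : Finset (Fin p)}
    (hJ : J.card = k) {t δ : ℝ} (hδ : 0 < δ) :
    Measure.pi (fun j => if j ∈ J then (volume[|Set.Icc (-(b / 2)) (b / 2)] : Measure ℝ)
        else Measure.dirac 0)
      {β | ¬((nonNulls β).card ≤ k ∧ (1 - δ) * k ≤ ((strongSignals t β).card : ℝ))} ≤
      ENNReal.ofReal (2 * t / (b * δ)) := by
  set μ : Fin p → Measure ℝ := fun j =>
    if j ∈ J then (volume[|Set.Icc (-(b / 2)) (b / 2)] : Measure ℝ) else Measure.dirac 0 with hμ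
  have hprob : ∀ j, IsProbabilityMeasure (μ j) := by
    intro j
    have := isProbabilityMeasure_uniform hb
    simp only [hμ]
    split_ifs <;> infer_instance
  have hmarg : ∀ j (S : Set ℝ), MeasurableSet S → Measure.pi μ {β | β j ∈ S} = μ j S := fun j S hS =>
    (measurePreserving_eval μ j).measure_preimage hS.nullMeasurableSet
  set N : (Fin p → ℝ) → ℝ≥0∞ := fun β => ∑ j ∈ J, if |β j| < t then 1 else 0 with hN
  have hset : ∀ j, MeasurableSet {β : Fin p → ℝ | |β j| < t} := fun j =>
    measurableSet_lt (measurable_pi_apply j).abs measurable_const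
  have hNm : Measurable N := Finset.measurable_fun_sum _ fun j _ =>
    Measurable.ite (hset j) measurable_const measurable_const
  have hzero : ∀ᵐ β ∂(Measure.pi μ), ∀ j, j ∉ J → β j = 0 := by
    rw [ae_all_iff]
    intro j
    by_cases hj : j ∈ J
    · exact ae_of_all _ fun β h => absurd hj h
    · rw [ae_iff]
      have h := hmarg j {0}ᶜ (measurableSet_singleton 0).compl
      simpa [hμ, hj] using h
  have hNint : ∫⁻ β, N β ∂(Measure.pi μ) ≤ k * ENNReal.ofReal (2 * t / b) := by
    calc ∫⁻ β, N β ∂(Measure.pi μ)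
        = ∑ j ∈ J, Measure.pi μ {β | |β j| < t} := by
          simp only [hN]
          rw [lintegral_finsetSum _ fun j _ =>
            Measurable.ite (hset j) measurable_const measurable_const]
          refine Finset.sum_congr rfl fun j _ => ?_
          rw [← lintegral_indicator_one (hset j)]
          rfl
      _ ≤ ∑ _j ∈ J, ENNReal.ofReal (2 * t / b) := by
          refine Finset.sum_le_sum fun j hj => ?_
          have h := hmarg j {x | |x| < t} (measurableSet_lt measurable_id.abs measurable_const)
          refine h.trans_le ?_
          simp only [hμ, if_pos hj]
          exact uniform_abs_lt_le hb
      _ = _ := by rw [Finset.sum_const, hJ, nsmul_eq_mul]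
  have hkδ : 0 < δ * k := by positivity
  calc Measure.pi μ
        {β | ¬((nonNulls β).card ≤ k ∧ (1 - δ) * k ≤ ((strongSignals t β).card : ℝ))}
      ≤ Measure.pi μ {β | ENNReal.ofReal (δ * k) ≤ N β} := by
        -- The inclusion holds only almost everywhere: coordinates outside `J` vanish almost surely.
        refine measure_mono_ae ?_
        filter_upwards [hzero] with β h0 hbad
        by_contra hlt
        apply hbad
        have hnn : nonNulls β ⊆ J := by
          intro j hj
          by_contra hjJ
          simp [nonNulls, h0 j hjJ] at hj
        refine ⟨hJ ▸ Finset.card_le_card hnn, ?_⟩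
        have hNcard : N β = ((J.filter fun j => |β j| < t).card : ℝ≥0∞) := by
          simp only [hN, Finset.natCast_card_filter]
        have hlt' : ((J.filter fun j => |β j| < t).card : ℝ) < δ * k := by
          have h := not_le.1 hlt
          rw [hNcard, ENNReal.lt_ofReal_iff_toReal_lt (ENNReal.natCast_ne_top _)] at h
          simpa using h
        have hsplit := Finset.card_filter_add_card_filter_not (s := J) (fun j => |β j| < t)
        have hsub : (J.filter fun j => ¬|β j| < t).card ≤ (strongSignals t β).card :=
          Finset.card_le_card fun j hj => mem_strongSignals.2 (not_lt.1 (Finset.mem_filter.1 hj).2)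
        have h1 : (k : ℝ) ≤ ((J.filter fun j => |β j| < t).card : ℝ) +
            ((strongSignals t β).card : ℝ) := by
          exact_mod_cast (by omega : k ≤ (J.filter fun j => |β j| < t).card +
            (strongSignals t β).card)
        linarith
    _ ≤ (∫⁻ β, N β ∂(Measure.pi μ)) / ENNReal.ofReal (δ * k) :=
        meas_ge_le_lintegral_div hNm.aemeasurable (by simpa using hkδ) ENNReal.ofReal_ne_top
    _ ≤ (k * ENNReal.ofReal (2 * t / b)) / ENNReal.ofReal (δ * k) :=
        ENNReal.div_le_div_right hNint _
    _ = ENNReal.ofReal (2 * t / (b * δ)) := by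
        have hk' : (0 : ℝ) < k := by exact_mod_cast hk
        rw [← ENNReal.ofReal_natCast k, ← ENNReal.ofReal_mul hk'.le,
          ← ENNReal.ofReal_div_of_pos hkδ]
        congr 1
        field_simp

/-- With large probability, there are at most `k` non-nulls, nearly all of them with coefficients
bounded away from zero. -/
lemma coefLaw_not_strongSignals_le (hb : 0 < b) {k : ℕ} (hk : 0 < k) {t δ : ℝ} (hδ : 0 < δ) :
    coefLaw p k b
      {β | ¬((nonNulls β).card ≤ k ∧ (1 - δ) * k ≤ ((strongSignals t β).card : ℝ))} ≤
      ENNReal.ofReal (2 * t / (b * δ)) := by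
  unfold coefLaw
  rw [Measure.smul_apply, Measure.finsetSum_apply, smul_eq_mul]
  refine (mul_le_mul_right (Finset.sum_le_sum (g := fun _ => ENNReal.ofReal (2 * t / (b * δ)))
    fun J hJ => ?_) _).trans ?_
  · convert pi_not_strongSignals_le hb hk (Finset.mem_powersetCard.1 hJ).2 hδ
  -- The weights sum to at most `1`, also when there is no set of size `k` and the sum is empty.
  · rw [Finset.sum_const, nsmul_eq_mul, ← mul_assoc]
    exact mul_le_of_le_one_left' (ENNReal.inv_mul_le_one _)

end Coefficients

/-! ### The two limits -/

lemma tendsto_iSup_dataLaw {p : ℕ → ℕ}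
    (hpn : (fun n => (p n : ℝ)) =o[atTop] (fun n : ℕ => (n : ℝ))) {γ : ℝ} (hγ : 0 < γ)
    {Sig : ∀ n, Matrix (Fin (p n)) (Fin (p n)) ℝ} (hSig : ∀ n, (Sig n).PosSemidef)
    (hmin : ∀ n i, γ ≤ (hSig n).isHermitian.eigenvalues i)
    {s : ∀ n, Fin (p n) → ℝ} (hs : ∀ n, IsMVR (Sig n) (s n)) (σ : ℝ≥0) {ε : ℝ} (hε : 0 < ε) :
    Tendsto (fun n => ⨆ β : Fin (p n) → ℝ, dataLaw n (Sig n) (s n) σ β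
      {D | ε < ∑ j, (olsStat (design D) (response D) j - |β j|) ^ 2}) atTop (𝓝 0) := by
  have hratio : Tendsto (fun n : ℕ => (p n : ℝ) / n) atTop (𝓝 0) := hpn.tendsto_div_nhds_zero
  have hlim : Tendsto (fun n : ℕ => ENNReal.ofReal (8 * σ ^ 2 / (γ * ε) * ((p n : ℝ) / n)))
      atTop (𝓝 0) := by
    have h := (ENNReal.continuous_ofReal.tendsto _).comp
      (hratio.const_mul (8 * (σ : ℝ) ^ 2 / (γ * ε)))
    simpa [Function.comp_def] using h
  refine tendsto_of_tendsto_of_tendsto_of_le_of_le' tendsto_const_nhds hlim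
    (Eventually.of_forall fun n => zero_le) ?_
  -- `p < n/8` and `n ≥ 4` give `n - 2p - 1 ≥ n/2`; with the trace bound `2p/γ` this produces the
  -- constant `8`.
  filter_upwards [hratio.eventually (gt_mem_nhds (by norm_num : (0 : ℝ) < 1 / 8)),
    eventually_ge_atTop 4] with n hn hn4
  have hn4' : (4 : ℝ) ≤ n := by exact_mod_cast hn4
  have hn0 : (0 : ℝ) < n := by linarith
  rw [div_lt_iff₀ hn0] at hn
  have hn2 : 2 * p n + 2 ≤ n := by
    have : (2 * p n + 2 : ℝ) ≤ n := by linarith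
    exact_mod_cast this
  obtain ⟨hG, htr⟩ := (hs n).posDef_and_trace_le (hSig n).isHermitian hγ (hmin n)
  refine iSup_le fun β => (dataLaw_lt_sum_sq_olsStat_sub_le hG hn2 σ β hε).trans ?_
  refine ENNReal.ofReal_le_ofReal ?_
  have hden : (n : ℝ) / 2 ≤ (n : ℝ) - 2 * p n - 1 := by linarith
  calc 2 * (σ : ℝ) ^ 2 * ((jointCov (Sig n) (s n))⁻¹).trace / ((n : ℝ) - 2 * p n - 1) / ε
      ≤ 2 * (σ : ℝ) ^ 2 * (2 * p n / γ) / ((n : ℝ) / 2) / ε := by gcongr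
    _ = 8 * σ ^ 2 / (γ * ε) * ((p n : ℝ) / n) := by
        field_simp
        ring

/-- One factor `1 - δ` is lost to the bad data event and one to the weak non-nulls, and `(1 - δ)² ≥
1 - 2δ`. Since `δ ≤ 1/2`, at least `k/2` signals are strong, enough to absorb the `+1`. -/
lemma abs_power_sub_one_le {n p : ℕ} {Sig : Matrix (Fin p) (Fin p) ℝ} {s : Fin p → ℝ} (σ : ℝ≥0)
    {q τ δ : ℝ} (hq0 : 0 < q) (hτ : 0 < τ) (hδ0 : 0 ≤ δ) (hδ1 : δ ≤ 1 / 2) {k : ℕ}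
    (hk : 1 ≤ q * (k / 2)) {β : Fin p → ℝ} (hnn : (nonNulls β).card ≤ k)
    (hst : (1 - δ) * k ≤ ((strongSignals (2 * τ) β).card : ℝ))
    (hprob : dataLaw n Sig s σ β
      {D | τ ^ 2 / 2 < ∑ j, (olsStat (design D) (response D) j - |β j|) ^ 2} ≤
        ENNReal.ofReal δ) :
    |power (n := n) Sig s σ q olsStat β - 1| ≤ 2 * δ := by
  have hk0 : (0 : ℝ) < k := by
    by_contra! h
    nlinarith
  have hst' : (k : ℝ) / 2 ≤ ((strongSignals (2 * τ) β).card : ℝ) := by nlinarith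
  have hq : 1 ≤ q * ((strongSignals (2 * τ) β).card : ℝ) := hk.trans (by gcongr)
  have hle := le_power_olsStat (n := n) (Sig := Sig) (s := s) σ hq0 hτ β hq
  have hge := power_olsStat_le_one (n := n) (Sig := Sig) (s := s) σ q β
  have hreal : (dataLaw n Sig s σ β).real
      {D | τ ^ 2 / 2 < ∑ j, (olsStat (design D) (response D) j - |β j|) ^ 2} ≤ δ :=
    ENNReal.toReal_le_of_le_ofReal hδ0 hprob
  have hcard : (strongSignals (2 * τ) β).card ≤ (nonNulls β).card :=
    Finset.card_le_card (strongSignals_subset_nonNulls (by positivity) β)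
  have hcard' : ((strongSignals (2 * τ) β).card : ℝ) ≤ ((nonNulls β).card : ℝ) := by
    exact_mod_cast hcard
  have hnn' : ((nonNulls β).card : ℝ) ≤ k := by exact_mod_cast hnn
  have hpos : (0 : ℝ) < (nonNulls β).card := by linarith
  have hfrac : 1 - δ ≤ ((strongSignals (2 * τ) β).card : ℝ) / (nonNulls β).card := by
    rw [le_div_iff₀ hpos]
    have : (1 - δ) * ((nonNulls β).card : ℝ) ≤ (1 - δ) * k :=
      mul_le_mul_of_nonneg_left hnn' (by linarith)
    linarith
  have hprod : (1 - δ) * (1 - δ) ≤ (1 - (dataLaw n Sig s σ β).real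
      {D | τ ^ 2 / 2 < ∑ j, (olsStat (design D) (response D) j - |β j|) ^ 2}) *
        (((strongSignals (2 * τ) β).card : ℝ) / (nonNulls β).card) :=
    mul_le_mul (by linarith) hfrac (by linarith) (by linarith)
  rw [abs_le]
  constructor <;> nlinarith

end Knockoff

theorem theorem3p3
    -- the number of features as a function of the sample size
    (p : ℕ → ℕ) (hp : Tendsto p atTop atTop)
    (hpn : (fun n => (p n : ℝ)) =o[atTop] (fun n : ℕ => (n : ℝ)))
    -- the covariance matrices, with smallest eigenvalues at least `γ > 0`
    (γ : ℝ) (hγ : 0 < γ)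
    (Sig : ∀ n, Matrix (Fin (p n)) (Fin (p n)) ℝ) (hSig : ∀ n, (Sig n).PosSemidef)
    (hmin : ∀ n i, γ ≤ (hSig n).isHermitian.eigenvalues i)
    -- the MVR choices
    (s : ∀ n, Fin (p n) → ℝ) (hs : ∀ n, Knockoff.IsMVR (Sig n) (s n))
    -- the noise level, the nominal FDR level, the fraction of non-nulls, the side length
    (σ : ℝ≥0) (q : ℝ) (hq0 : 0 < q) (hq1 : q ≤ 1)
    (s0 : ℝ) (hs0 : 0 < s0) (hs1 : s0 ≤ 1) (b : ℝ) (hb : 0 < b)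
    -- the random coefficients
    {Ω : Type*} [MeasurableSpace Ω] (P : Measure Ω) [IsProbabilityMeasure P]
    (β : ∀ n, Ω → Fin (p n) → ℝ)
    (hβ : ∀ n, HasLaw (β n) (Knockoff.coefLaw (p n) ⌈s0 * (p n : ℝ)⌉₊ b) P) :
    (∀ ε : ℝ, 0 < ε → Tendsto (fun n => ⨆ b' : Fin (p n) → ℝ,
        Knockoff.dataLaw n (Sig n) (s n) σ b'
          {D | ε < ∑ j, (Knockoff.olsStat (Knockoff.design D) (Knockoff.response D) j
            - |b' j|) ^ 2}) atTop (𝓝 0)) ∧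
    TendstoInMeasure P
      (fun n ω => Knockoff.power (n := n) (Sig n) (s n) σ q Knockoff.olsStat (β n ω))
      atTop (fun _ => 1) := by

  have hfirst : ∀ ε : ℝ, 0 < ε → Tendsto (fun n => ⨆ b' : Fin (p n) → ℝ,
      Knockoff.dataLaw n (Sig n) (s n) σ b'
        {D | ε < ∑ j, (Knockoff.olsStat (Knockoff.design D) (Knockoff.response D) j
          - |b' j|) ^ 2}) atTop (𝓝 0) := fun ε hε =>
    Knockoff.tendsto_iSup_dataLaw hpn hγ hSig hmin hs σ hε
  refine ⟨hfirst, ?_⟩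
  rw [tendstoInMeasure_iff_norm]
  intro ε hε
  rw [ENNReal.tendsto_nhds_zero]
  intro η' hη'
  obtain ⟨η, hη0, hη⟩ : ∃ η : ℝ, 0 < η ∧ ENNReal.ofReal η ≤ η' := by
    rcases eq_or_ne η' ⊤ with h | h
    · exact ⟨1, one_pos, h ▸ le_top⟩
    · exact ⟨η'.toReal, ENNReal.toReal_pos hη'.ne' h, ENNReal.ofReal_toReal_le⟩
  set δ : ℝ := min ε 1 / 4 with hδ
  have hδ0 : 0 < δ := by positivity
  have hδ1 : δ ≤ 1 / 2 := by
    have := min_le_right ε 1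
    linarith
  have hδε : 2 * δ < ε := by
    have := min_le_left ε 1
    linarith
  -- Chosen so that the bound `2(2τ)/(bδ)` on the probability of bad coefficients equals `η`.
  set τ : ℝ := η * (b * δ) / 4 with hτdef
  have hτ : 0 < τ := by positivity
  have hsup := (ENNReal.tendsto_nhds_zero.1 (hfirst (τ ^ 2 / 2) (by positivity)))
    (ENNReal.ofReal δ) (by simpa using hδ0)
  have hplim : Tendsto (fun n => q * (s0 * (p n : ℝ) / 2)) atTop atTop :=
    ((tendsto_natCast_atTop_atTop.comp hp).const_mul_atTop hs0 |>.atTop_div_const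
      two_pos).const_mul_atTop hq0
  filter_upwards [hsup, hplim.eventually_ge_atTop 1] with n hn hpn1
  set k := ⌈s0 * (p n : ℝ)⌉₊ with hk
  have hkge : s0 * (p n : ℝ) ≤ k := Nat.le_ceil _
  have hk1 : 1 ≤ q * ((k : ℝ) / 2) := hpn1.trans (by gcongr)
  have hkpos : 0 < k := by
    rcases Nat.eq_zero_or_pos k with h | h
    · rw [h] at hk1
      norm_num at hk1
    · exact h
  calc P {ω | ε ≤ ‖Knockoff.power (n := n) (Sig n) (s n) σ q Knockoff.olsStat (β n ω) - 1‖}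
      ≤ P (β n ⁻¹' {β | ¬((Knockoff.nonNulls β).card ≤ k ∧
          (1 - δ) * k ≤ ((Knockoff.strongSignals (2 * τ) β).card : ℝ))}) := by
        refine measure_mono fun ω hω => ?_
        rintro ⟨h1, h2⟩
        have h := Knockoff.abs_power_sub_one_le (n := n) (Sig := Sig n) (s := s n) σ hq0 hτ
          hδ0.le hδ1 hk1 h1 h2 ((le_iSup (fun b' : Fin (p n) → ℝ =>
            Knockoff.dataLaw n (Sig n) (s n) σ b'
              {D | τ ^ 2 / 2 < ∑ j, (Knockoff.olsStat (Knockoff.design D)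
                (Knockoff.response D) j - |b' j|) ^ 2}) (β n ω)).trans hn)
        have hω' : ε ≤ ‖Knockoff.power (n := n) (Sig n) (s n) σ q Knockoff.olsStat (β n ω) - 1‖ :=
          hω
        rw [Real.norm_eq_abs] at hω'
        linarith
    -- This direction holds for arbitrary sets, so the event need not be shown measurable.
    _ ≤ (P.map (β n)) {β | ¬((Knockoff.nonNulls β).card ≤ k ∧
          (1 - δ) * k ≤ ((Knockoff.strongSignals (2 * τ) β).card : ℝ))} :=
        Measure.le_map_apply (hβ n).aemeasurable _
    _ ≤ ENNReal.ofReal (2 * (2 * τ) / (b * δ)) := by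
        rw [(hβ n).map_eq]
        exact Knockoff.coefLaw_not_strongSignals_le hb hkpos hδ0
    _ = ENNReal.ofReal η := by
        congr 1
        rw [hτdef]
        field_simp
        ring
    _ ≤ η' := hη
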